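/- Let $n\ge 1$, $\alpha\in(0,1)$ and $\mu_{n,\alpha}=2^\alpha\pi^{-n/2}\,\Gamma\left(\frac{n+\alpha+1}{2}\right)/\Gamma\left(\frac{1-\alpha}{2}\right)$. For $\varphi\in C^\infty_c(\mathbb{R}^n;\mathbb{R}^n)$ let $$\operatorname{div}^\alpha\varphi(x)=\mu_{n,\alpha}\int_{\mathbb{R}^n}\frac{(\varphi(y)-\varphi(x))\cdot(y-x)}{|y-x|^{n+\alpha+1}}\,dy,\qquad x\in\mathbb{R}^n .$$ Let $f\in BV^{\alpha,\infty}_{\mathrm{loc}}(\mathbb{R}^n)$, that is, $f\in L^\infty(\mathbb{R}^n)$ and $$\sup\left\{\int_{\mathbb{R}^n}f\,\operatorname{div}^\alpha\varphi\,dx \;:\; \varphi\in C^\infty_c(\mathbb{R}^n;\mathbb{R}^n),\ \|\varphi\|_{L^\infty(\mathbb{R}^n;\mathbb{R}^n)}\le 1,\ \operatorname{supp}\varphi\subset A\right\}<+\infty$$ for every relatively compact open set $A\subset\mathbb{R}^n$, and let $i\in\{1,\dots,n\}$. Then $f$ has a fractional $\alpha$-variation measure, that is, there is an $\mathbb{R}^n$-valued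 Radon measure $D^\alpha f=(D^\alpha_1f,\dots,D^\alpha_nf)$ on $\mathbb{R}^n$ (of locally finite total variation) such that $$\int_{\mathbb{R}^n}f\,\operatorname{div}^\alpha\varphi\,dx=-\int_{\mathbb{R}^n}\varphi\cdot dD^\alpha f\qquad\text{for all }\varphi\in C^\infty_c(\mathbb{R}^n;\mathbb{R}^n),$$ and, for any such measure $D^\alpha f$, its $i$-th component satisfies $$D^\alpha_i f=0\quad\Longleftrightarrow\quad D_if=0,$$ where $D_if$ denotes the $i$-th partial derivative of $f$ in the sense of distributions on $\mathbb{R}^n$. -/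

import Mathlib

open MeasureTheory TopologicalSpace
open scoped ENNReal Distributions

noncomputable section

namespace FracBV

/-- The Euclidean space `ℝⁿ`. -/
abbrev E (n : ℕ) : Type := EuclideanSpace ℝ (Fin n)

/-- The renormalization constant
`μ_{n,α} = 2^α π^{-n/2} Γ((n+α+1)/2) / Γ((1-α)/2)`. -/
def mu (n : ℕ) (α : ℝ) : ℝ :=
  (2 : ℝ) ^ α * Real.pi ^ (-(n : ℝ) / 2) *
    (Real.Gamma (((n : ℝ) + α + 1) / 2) / Real.Gamma ((1 - α) / 2))

/-- The fractional `α`-divergence of a vector field `φ`,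
`div^α φ(x) = μ_{n,α} ∫ (φ(y) - φ(x)) · (y - x) / |y - x|^{n+α+1} dy`. -/
def fracDiv {n : ℕ} (α : ℝ) (φ : E n → E n) (x : E n) : ℝ :=
  mu n α * ∫ y : E n, inner ℝ (φ y - φ x) (y - x) / ‖y - x‖ ^ ((n : ℝ) + α + 1)

/-- `f ∈ BV^{α,p}_loc(ℝⁿ)`: the function `f` belongs to `L^p(ℝⁿ)` and, for every relatively
compact open set `A`, the numbers `∫ f div^α φ dx`, with `φ ∈ C_c^∞(A; ℝⁿ)` and `|φ| ≤ 1`,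
are bounded from above. -/
def MemBVLoc {n : ℕ} (α : ℝ) (p : ℝ≥0∞) (f : E n → ℝ) : Prop :=
  MemLp f p volume ∧
    ∀ A : Opens (E n), IsCompact (closure (A : Set (E n))) →
      BddAbove {r : ℝ | ∃ φ : 𝓓(A, E n), (∀ x, ‖φ x‖ ≤ 1) ∧ r = ∫ x, f x * fracDiv α φ x}

/-- An `ℝⁿ`-valued Radon measure on `ℝⁿ`, given by its polar decomposition `σ |ν|`: the total
variation `|ν|` is a Borel measure which is finite on compact sets, and `σ` is a Borel unit
vector field, defined `|ν|`-almost everywhere. -/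
structure RadonVectorMeasure (n : ℕ) where
  /-- The total variation measure. -/
  totalVar : Measure (E n)
  /-- The polar density. -/
  density : E n → E n
  finite_on_compacts : IsFiniteMeasureOnCompacts totalVar
  measurable_density : Measurable density
  norm_density : ∀ᵐ x ∂totalVar, ‖density x‖ = 1

namespace RadonVectorMeasure

variable {n : ℕ}

open Classical in
/-- The value `ν(A) ∈ ℝⁿ` on a bounded Borel set `A`. (A Radon vector measure is a set function on
the bounded Borel sets; by convention we assign the value `0` to every other set.) -/
def val (ν : RadonVectorMeasure n) (A : Set (E n)) : E n :=
  if MeasurableSet A ∧ Bornology.IsBounded A then ∫ x in A, ν.density x ∂ν.totalVar else 0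

/-- The `i`-th component `ν_i` of `ν`, a real-valued Radon measure, as a set function. -/
def component (ν : RadonVectorMeasure n) (i : Fin n) : Set (E n) → ℝ :=
  fun A => ν.val A i

/-- The integral `∫ φ · dν` of a vector field. -/
def integral (ν : RadonVectorMeasure n) (φ : E n → E n) : ℝ :=
  ∫ x, inner ℝ (φ x) (ν.density x) ∂ν.totalVar

end RadonVectorMeasure

/-- `ν` is the fractional `α`-variation measure `D^α f` of `f`:
`∫ f div^α φ dx = - ∫ φ · dν` for all `φ ∈ C_c^∞(ℝⁿ; ℝⁿ)`. -/
def IsFracVariation {n : ℕ} (α : ℝ) (f : E n → ℝ) (ν : RadonVectorMeasure n) : Prop :=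
  ∀ φ : 𝓓((⊤ : Opens (E n)), E n), ∫ x, f x * fracDiv α φ x = - ν.integral φ

/-- The distribution `φ ↦ ∫ φ f dx` on `ℝⁿ` induced by a locally integrable function `f`. -/
def toDistribution {n : ℕ} (f : E n → ℝ) : 𝓓'((⊤ : Opens (E n)), ℝ) where
  toFun := TestFunction.integralAgainstBilinCLM (ContinuousLinearMap.mul ℝ ℝ) volume f
  map_add' := map_add _
  map_smul' := map_smul _
  cont := ContinuousLinearMap.continuous _

/-- The distributional partial derivative `D_i f` of a locally integrable function `f`. -/
def distribDeriv {n : ℕ} (i : Fin n) (f : E n → ℝ) : 𝓓'((⊤ : Opens (E n)), ℝ) :=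
  LineDeriv.lineDerivOp (EuclideanSpace.single i (1 : ℝ)) (toDistribution f)

/-- `⟨D_i f, φ⟩ = - ∫ (∂_i φ) f dx`. -/
theorem distribDeriv_apply {n : ℕ} (i : Fin n) {f : E n → ℝ} (hf : LocallyIntegrable f volume)
    (φ : 𝓓((⊤ : Opens (E n)), ℝ)) :
    distribDeriv i f φ =
      - ∫ x, lineDeriv ℝ φ x (EuclideanSpace.single i (1 : ℝ)) * f x := by
  have h : distribDeriv i f φ =
      - TestFunction.integralAgainstBilinCLM (ContinuousLinearMap.mul ℝ ℝ) volume f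
        (TestFunction.lineDerivCLM ℝ (EuclideanSpace.single i (1 : ℝ)) φ :
          𝓓((⊤ : Opens (E n)), ℝ)) := rfl
  rw [h, TestFunction.integralAgainstBilinCLM_eq_integral (hf.locallyIntegrableOn _)]
  simp

end FracBV

end

namespace FracBV

open Metric Filter Topology FourierTransform

set_option linter.unusedSectionVars false

variable {V : Type*} [NormedAddCommGroup V] [InnerProductSpace ℝ V] [FiniteDimensional ℝ V]
  [MeasurableSpace V] [BorelSpace V]
  {F : Type*} [NormedAddCommGroup F] [NormedSpace ℝ F]

/-! ### Difference operators -/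

/-! Up to the positive factor `mu`, the fractional divergence is a sum over the coordinates of
operators `diffOp k`, that is, superpositions of differences, with odd kernels homogeneous of degree
-(n + α). Let T be the operator with kernel `coordKernel α i`. Then D^α_i f = 0 means that f
annihilates T u for every test function u, and D_i f = 0 means that f annihilates every ∂_i u.

From fractional to classical: ∂_i is a constant multiple of S T, with S a fractional Laplacian of
order 1 - α (`exists_diffOp_diffOp_eq`, by comparing Fourier symbols). As f is bounded, Fubini
(`integral_mul_diffOp`) writes ∫ f S(T φ) as a superposition of the integrals ∫ f diff_h(T φ) = ∫ f
T(diff_h φ). Each of them vanishes because diff_h φ is again a test function. Thus it does no harm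
that T φ need not have compact support.

From classical to fractional: D_i f = 0 makes h ↦ ∫ f(x) φ(x + h) dx constant along e_i, hence
invariant under the reflection in the hyperplane orthogonal to e_i. The kernel of T changes sign
under this reflection, so ∫ f T φ equals its own negative.

The constants in the symbols are never evaluated: isometry invariance and homogeneity determine the
symbols up to a factor, and positivity of the kernels on a ball shows that it is nonzero
(`exists_symbol_ne_zero`).

Existence: the variation bound makes each component functional locally bounded on test functions. It
extends to C_c by uniform approximation, splits into a difference of positive functionals, and
Riesz–Markov represents both. `exists_radonVectorMeasure` assembles the components into polar form.
-/

/-- The forward difference `x ↦ g (x + h) - g x`. -/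
def diff (h : V) (g : V → F) (x : V) : F := g (x + h) - g x

/-- The superposition `x ↦ ∫ k(h) (g(x + h) - g(x)) dh` of differences. -/
noncomputable def diffOp (k : V → ℝ) (g : V → F) (x : V) : F := ∫ h, k h • diff h g x

/-- A measurable kernel `k` for which `∫ |k(h)| min(1, |h|) dh` is finite. -/
structure IsLevyKernel (k : V → ℝ) : Prop where
  measurable : Measurable k
  integrable : Integrable fun h => k h * min 1 ‖h‖

/-- An integrable function which is Lipschitz with respect to translations in `L¹`. -/
structure IsL1Lipschitz (g : V → F) : Prop where
  integrable : Integrable g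
  exists_bound : ∃ C : ℝ, ∀ h : V, ∫ x, ‖diff h g x‖ ≤ C * min 1 ‖h‖

theorem min_one_norm_nonneg (h : V) : 0 ≤ min 1 ‖h‖ := le_min zero_le_one (norm_nonneg h)

theorem diff_comm (h z : V) (g : V → F) : diff z (diff h g) = diff h (diff z g) := by
  ext x
  simp only [diff, add_right_comm x z h]
  abel

theorem integrable_diff {g : V → F} (hg : Integrable g) (h : V) : Integrable (diff h g) :=
  (hg.comp_add_right h).sub hg

theorem integral_norm_diff_le {g : V → F} (hg : Integrable g) (h : V) :
    ∫ x, ‖diff h g x‖ ≤ 2 * ∫ x, ‖g x‖ := by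
  calc ∫ x, ‖diff h g x‖ ≤ ∫ x, (‖g (x + h)‖ + ‖g x‖) :=
        integral_mono (integrable_diff hg h).norm ((hg.comp_add_right h).norm.add hg.norm)
          fun x => norm_sub_le _ _
    _ = 2 * ∫ x, ‖g x‖ := by
        rw [integral_add (hg.comp_add_right h).norm hg.norm,
          integral_add_right_eq_self (fun x => ‖g x‖)]
        ring

/-- A bounded Lipschitz function with bounded support is Lipschitz with respect to translations
in `L¹`. -/
theorem integral_norm_diff_le_of_lipschitz {g : V → F} {K R : ℝ} (hgi : Integrable g)
    (hK : ∀ x, ‖g x‖ ≤ K) (hL : ∀ x y, ‖g x - g y‖ ≤ K * ‖x - y‖)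
    (hR : ∀ x, R < ‖x‖ → g x = 0) (h : V) :
    ∫ x, ‖diff h g x‖ ≤ 2 * K * volume.real (closedBall (0 : V) (R + 1)) * min 1 ‖h‖ := by
  have hK0 : 0 ≤ K := (norm_nonneg _).trans (hK 0)
  -- The radius R + 1 serves both for `g` and for `diff h g` with ‖h‖ ≤ 1.
  have key : ∀ (c : ℝ) (u : V → F), Integrable u → (∀ x, ‖u x‖ ≤ c) →
      (∀ x, R + 1 < ‖x‖ → u x = 0) →
      ∫ x, ‖u x‖ ≤ c * volume.real (closedBall (0 : V) (R + 1)) := by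
    intro c u hu hc hz
    have h1 : Integrable ((closedBall (0 : V) (R + 1)).indicator fun _ => c) :=
      (integrable_indicator_iff measurableSet_closedBall).2
        (integrableOn_const (isCompact_closedBall _ _).measure_lt_top.ne)
    calc ∫ x, ‖u x‖ ≤ ∫ x, (closedBall (0 : V) (R + 1)).indicator (fun _ => c) x := by
          refine integral_mono hu.norm h1 fun x => ?_
          by_cases hx : x ∈ closedBall (0 : V) (R + 1)
          · simpa [Set.indicator_of_mem hx] using hc x
          · rw [Set.indicator_of_notMem hx]
            simp only [mem_closedBall, dist_zero_right, not_le] at hx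
            simp [hz x hx]
      _ = c * volume.real (closedBall (0 : V) (R + 1)) := by
          rw [integral_indicator measurableSet_closedBall, setIntegral_const, smul_eq_mul, mul_comm]
  rcases le_total 1 ‖h‖ with h1 | h1
  · rw [min_eq_left h1, mul_one]
    refine (integral_norm_diff_le hgi h).trans ?_
    have := key K g hgi hK fun x hx => hR x (by linarith)
    linarith
  · rw [min_eq_right h1]
    have := key (K * ‖h‖) (diff h g) (integrable_diff hgi h)
      (fun x => by simpa [diff] using hL (x + h) x) (fun x hx => by
        have h2 : R < ‖x + h‖ := by
          have := norm_sub_le (x + h) h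
          rw [add_sub_cancel_right] at this
          linarith
        rw [diff, hR _ h2, hR x (by linarith), sub_zero])
    have h3 : 0 ≤ K * ‖h‖ * volume.real (closedBall (0 : V) (R + 1)) := by positivity
    nlinarith

theorem exists_lipschitz_bound {g : V → F} (hg : ContDiff ℝ 1 g) (hs : HasCompactSupport g) :
    ∃ K : ℝ, (∀ x, ‖g x‖ ≤ K) ∧ ∀ x y, ‖g x - g y‖ ≤ K * ‖x - y‖ := by
  obtain ⟨K₀, hK₀⟩ : ∃ K, ∀ x, ‖g x‖ ≤ K := hs.exists_bound_of_continuous hg.continuous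
  obtain ⟨K₁, hK₁⟩ : ∃ K, ∀ x, ‖fderiv ℝ g x‖ ≤ K :=
    (hs.fderiv (𝕜 := ℝ)).exists_bound_of_continuous (hg.continuous_fderiv (by norm_num))
  exact ⟨max K₀ K₁, fun x => (hK₀ x).trans (le_max_left _ _), fun x y =>
    convex_univ.norm_image_sub_le_of_norm_fderiv_le (𝕜 := ℝ)
      (fun z _ => hg.differentiable (by norm_num) z)
      (fun z _ => (hK₁ z).trans (le_max_right _ _)) (Set.mem_univ y) (Set.mem_univ x)⟩

theorem diff_eq_zero_of_lt_norm {g : V → F} {R : ℝ} (hR : ∀ x, R < ‖x‖ → g x = 0) {h : V}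
    (h1 : ‖h‖ ≤ 1) {x : V} (hx : R + 1 < ‖x‖) : diff h g x = 0 := by
  have := norm_sub_le (x + h) h
  rw [add_sub_cancel_right] at this
  rw [diff, hR _ (by linarith), hR x (by linarith), sub_zero]

theorem norm_diff_sub_diff_le {g : V → F} (hg : Differentiable ℝ g) {K : ℝ}
    (hK : ∀ x y, ‖fderiv ℝ g x - fderiv ℝ g y‖ ≤ K * ‖x - y‖) (h x y : V) :
    ‖diff h g x - diff h g y‖ ≤ K * ‖h‖ * ‖x - y‖ := by
  have hs : ∀ u, HasFDerivAt (diff h g) (fderiv ℝ g (u + h) - fderiv ℝ g u) u := fun u =>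
    ((hasFDerivAt_comp_add_right h).2 (hg (u + h)).hasFDerivAt).sub (hg u).hasFDerivAt
  refine convex_univ.norm_image_sub_le_of_norm_hasFDerivWithin_le (𝕜 := ℝ)
    (fun u _ => (hs u).hasFDerivWithinAt) (fun u _ => ?_) (Set.mem_univ y) (Set.mem_univ x)
  simpa using hK (u + h) u

/-- The product of the two minima lets a second difference operator act on the output of a first
one. If ‖h‖ ≥ 1, the outer difference in h costs a factor 2 and the one in z supplies the decay. If
‖h‖ ≤ 1, then `diff h g` is itself bounded and Lipschitz with constant proportional to ‖h‖, by the
bounds on the first two derivatives of g. -/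
theorem exists_bound_diff_diff {g : V → F} (hg : ContDiff ℝ 2 g) (hs : HasCompactSupport g) :
    ∃ C : ℝ, ∀ h z : V, ∫ x, ‖diff z (diff h g) x‖ ≤ C * min 1 ‖h‖ * min 1 ‖z‖ ∧
      ∫ x, ‖diff h g x‖ ≤ C * min 1 ‖h‖ := by
  have hgi : Integrable g := hg.continuous.integrable_of_hasCompactSupport hs
  obtain ⟨R, hR⟩ : ∃ R, ∀ x, R < ‖x‖ → g x = 0 := by
    obtain ⟨R, hR⟩ := hs.isCompact.isBounded.subset_closedBall 0
    refine ⟨R, fun x hx => ?_⟩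
    by_contra h0
    have := hR (subset_tsupport _ h0)
    simp at this
    linarith
  obtain ⟨K, hK, hL⟩ := exists_lipschitz_bound (hg.of_le (by norm_num)) hs
  obtain ⟨K', -, hL'⟩ := exists_lipschitz_bound
    (hg.fderiv_right (m := 1) (by norm_num)) (hs.fderiv (𝕜 := ℝ))
  set c : ℝ := volume.real (closedBall (0 : V) (R + 1))
  set c' : ℝ := volume.real (closedBall (0 : V) (R + 1 + 1))
  have hc : 0 ≤ c := measureReal_nonneg
  have hc' : 0 ≤ c' := measureReal_nonneg
  have hK0 : 0 ≤ K := (norm_nonneg _).trans (hK 0)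
  have hM : ∀ z : V, ∫ x, ‖diff z g x‖ ≤ 2 * K * c * min 1 ‖z‖ := fun z =>
    integral_norm_diff_le_of_lipschitz hgi hK hL hR z
  have hM0 : 0 ≤ 2 * K * c := by positivity
  have hN0 : 0 ≤ 2 * max K K' * c' := mul_nonneg (mul_nonneg two_pos.le (le_max_of_le_left hK0)) hc'
  refine ⟨2 * (2 * K * c) + 2 * max K K' * c', fun h z => ⟨?_, (hM h).trans ?_⟩⟩
  · have hw := min_one_norm_nonneg z
    rcases le_total 1 ‖h‖ with h1 | h1
    · rw [min_eq_left h1, mul_one, diff_comm]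
      refine (integral_norm_diff_le (integrable_diff hgi z) h).trans ?_
      have := hM z
      nlinarith
    · rw [min_eq_right h1]
      have hmul : K * ‖h‖ ≤ max K K' * ‖h‖ := by gcongr; exact le_max_left _ _
      have key := integral_norm_diff_le_of_lipschitz (g := diff h g) (K := max K K' * ‖h‖)
        (R := R + 1) (integrable_diff hgi h)
        (fun x => le_trans (by simpa [diff] using hL (x + h) x) hmul)
        (fun x y => norm_diff_sub_diff_le (hg.differentiable (by norm_num))
          (fun x y => (hL' x y).trans (by gcongr; exact le_max_right _ _)) h x y)
        (fun x hx => diff_eq_zero_of_lt_norm hR h1 hx) z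
      refine key.trans ?_
      have h4 : 2 * (max K K' * ‖h‖) * c' = 2 * max K K' * c' * ‖h‖ := by ring
      rw [h4]
      gcongr
      linarith
  · have := min_one_norm_nonneg h
    nlinarith

theorem isL1Lipschitz_of_contDiff {g : V → F} (hg : ContDiff ℝ 2 g) (hs : HasCompactSupport g) :
    IsL1Lipschitz g := by
  obtain ⟨C, hC⟩ := exists_bound_diff_diff hg hs
  exact ⟨hg.continuous.integrable_of_hasCompactSupport hs, C, fun h => (hC h 0).2⟩

theorem IsL1Lipschitz.diff {g : V → F} (hg : IsL1Lipschitz g) (z : V) :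
    IsL1Lipschitz (diff z g) := by
  obtain ⟨C, hC⟩ := hg.exists_bound
  refine ⟨integrable_diff hg.integrable z, 2 * C, fun h => ?_⟩
  rw [diff_comm]
  refine (integral_norm_diff_le (integrable_diff hg.integrable h) z).trans ?_
  linarith [hC h]

/-- Since g is only a.e. strongly measurable, composition needs a quasi-measure-preserving map;
addition is one, as a measure-preserving shear followed by a projection. -/
theorem aestronglyMeasurable_uncurry_diff {g : V → F} (hg : AEStronglyMeasurable g) :
    AEStronglyMeasurable (fun p : V × V => diff p.1 g p.2) (volume.prod volume) := by
  have h1 : Measure.QuasiMeasurePreserving (fun p : V × V => p.2 + p.1)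
      (volume.prod volume) volume := by
    have := (Measure.quasiMeasurePreserving_snd (μ := (volume : Measure V))
      (ν := (volume : Measure V))).comp
      (measurePreserving_prod_add (volume : Measure V) (volume : Measure V)).quasiMeasurePreserving
    simpa [Function.comp_def, add_comm] using this
  exact (hg.comp_quasiMeasurePreserving h1).sub
    (hg.comp_quasiMeasurePreserving Measure.quasiMeasurePreserving_snd)

/-- This justifies every use of Fubini below: integrating first in x leaves at most C |k(h)| min(1,
‖h‖), which is integrable by the Lévy condition. -/
theorem integrable_uncurry_diff {k : V → ℝ} (hk : IsLevyKernel k) {g : V → F}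
    (hg : IsL1Lipschitz g) :
    Integrable (fun p : V × V => k p.1 • diff p.1 g p.2) (volume.prod volume) := by
  obtain ⟨C, hC⟩ := hg.exists_bound
  have hm : AEStronglyMeasurable (fun p : V × V => k p.1 • diff p.1 g p.2)
      (volume.prod volume) :=
    (hk.measurable.comp measurable_fst).aestronglyMeasurable.smul
      (aestronglyMeasurable_uncurry_diff hg.integrable.1)
  rw [integrable_prod_iff hm]
  refine ⟨.of_forall fun h => (integrable_diff hg.integrable h).smul (k h), ?_⟩
  refine (hk.integrable.norm.const_mul C).mono' hm.norm.integral_prod_right' (.of_forall fun h => ?_)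
  rw [Real.norm_of_nonneg (integral_nonneg fun _ => norm_nonneg _)]
  simp only [norm_smul, integral_const_mul, norm_mul]
  rw [Real.norm_of_nonneg (min_one_norm_nonneg h)]
  nlinarith [mul_le_mul_of_nonneg_left (hC h) (norm_nonneg (k h))]

theorem integrable_diffOp {k : V → ℝ} (hk : IsLevyKernel k) {g : V → F}
    (hg : IsL1Lipschitz g) : Integrable (diffOp k g) :=
  (integrable_uncurry_diff hk hg).integral_prod_right

theorem ae_integrable_diff {k : V → ℝ} (hk : IsLevyKernel k) {g : V → F}
    (hg : IsL1Lipschitz g) : ∀ᵐ x, Integrable fun h => k h • diff h g x :=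
  (integrable_uncurry_diff hk hg).prod_left_ae

/-- The identity is claimed only a.e. because splitting the integral requires convergence at both x
and x + z. -/
theorem diff_diffOp {k : V → ℝ} (hk : IsLevyKernel k) {g : V → F}
    (hg : IsL1Lipschitz g) (z : V) : diff z (diffOp k g) =ᵐ[volume] diffOp k (diff z g) := by
  have h1 := ae_integrable_diff hk hg
  have h2 := (measurePreserving_add_right (volume : Measure V) z).quasiMeasurePreserving.ae h1
  filter_upwards [h1, h2] with x hx hx'
  rw [diff, diffOp, diffOp, diffOp, ← integral_sub hx' hx]
  congr 1 with h
  rw [← smul_sub, diff_comm z h g]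
  rfl

theorem isL1Lipschitz_diffOp {k : V → ℝ} (hk : IsLevyKernel k) {g : V → F} (hg : ContDiff ℝ 2 g)
    (hs : HasCompactSupport g) : IsL1Lipschitz (diffOp k g) := by
  have hL := isL1Lipschitz_of_contDiff hg hs
  obtain ⟨C, hC⟩ := exists_bound_diff_diff hg hs
  refine ⟨integrable_diffOp hk hL, C * ∫ h, ‖k h * min 1 ‖h‖‖, fun z => ?_⟩
  have hi := integrable_uncurry_diff hk (hL.diff z)
  calc ∫ x, ‖diff z (diffOp k g) x‖ = ∫ x, ‖diffOp k (diff z g) x‖ :=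
        integral_congr_ae ((diff_diffOp hk hL z).fun_comp norm)
    _ ≤ ∫ x, ∫ h, ‖k h • diff h (diff z g) x‖ :=
        integral_mono_ae (integrable_diffOp hk (hL.diff z)).norm hi.norm.integral_prod_right
          (.of_forall fun x => norm_integral_le_integral_norm _)
    _ = ∫ h, ∫ x, ‖k h • diff h (diff z g) x‖ := integral_integral_swap hi.norm.swap
    _ ≤ ∫ h, C * min 1 ‖z‖ * ‖k h * min 1 ‖h‖‖ := by
        refine integral_mono hi.norm.integral_prod_left (hk.integrable.norm.const_mul _) fun h => ?_
        simp only [norm_smul, integral_const_mul, norm_mul]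
        rw [Real.norm_of_nonneg (min_one_norm_nonneg h)]
        nlinarith [mul_le_mul_of_nonneg_left (hC z h).1 (norm_nonneg (k h))]
    _ = C * (∫ h, ‖k h * min 1 ‖h‖‖) * min 1 ‖z‖ := by rw [integral_const_mul]; ring

/-- Fubini's theorem for a bounded function tested against `diffOp k g`. -/
theorem integral_mul_diffOp {k : V → ℝ} (hk : IsLevyKernel k) {g : V → ℝ}
    (hg : IsL1Lipschitz g) {f : V → ℝ} (hf : MemLp f ∞ volume) :
    ∫ x, f x * diffOp k g x = ∫ h, k h * ∫ x, f x * diff h g x := by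
  have hi : Integrable (fun p : V × V => f p.2 * (k p.1 • diff p.1 g p.2))
      (volume.prod volume) := by
    have h1 : MemLp (fun p : V × V => f p.2) ∞ (volume.prod volume) :=
      memLp_top_of_bound (hf.1.comp_quasiMeasurePreserving Measure.quasiMeasurePreserving_snd)
        (lpNorm f ∞ volume) (Measure.quasiMeasurePreserving_snd.ae (ae_le_lpNorm_exponent_top hf))
    exact (integrable_uncurry_diff hk hg).mul_of_top_right h1
  calc ∫ x, f x * diffOp k g x = ∫ x, ∫ h, f x * (k h • diff h g x) := by
        simp only [diffOp, integral_const_mul]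
    _ = ∫ h, ∫ x, f x * (k h • diff h g x) := integral_integral_swap hi.swap
    _ = ∫ h, k h * ∫ x, f x * diff h g x := by
        congr 1 with h
        rw [← integral_const_mul]
        congr 1 with x
        simp only [smul_eq_mul]; ring

/-! ### Fourier symbols -/

/-- The Fourier symbol `∫ k(h) (exp(2πi⟨h, ξ⟩) - 1) dh` of `diffOp k`. -/
noncomputable def symbol (k : V → ℝ) (ξ : V) : ℂ :=
  ∫ h, k h • ((Real.fourierChar (inner ℝ h ξ) : ℂ) - 1)

/-- Translation by h becomes multiplication by a character, and Fubini integrates the resulting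
factors against k. -/
theorem fourier_diffOp {k : V → ℝ} (hk : IsLevyKernel k) {g : V → ℂ} (hg : IsL1Lipschitz g)
    (ξ : V) : 𝓕 (diffOp k g) ξ = symbol k ξ * 𝓕 g ξ := by
  have hi : Integrable (fun p : V × V => (Real.fourierChar (-inner ℝ p.2 ξ)) •
      (k p.1 • diff p.1 g p.2)) (volume.prod volume) := by
    have h0 := integrable_uncurry_diff hk hg
    refine (integrable_norm_iff (?_)).1 ?_
    · have : Continuous fun p : V × V => (Real.fourierChar (-inner ℝ p.2 ξ)) := by
        have := Real.continuous_fourierChar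
        fun_prop
      exact this.aestronglyMeasurable.smul h0.1
    · simpa only [Circle.norm_smul] using h0.norm
  have hd : ∀ h : V, 𝓕 (diff h g) ξ = ((Real.fourierChar (inner ℝ h ξ) : ℂ) - 1) * 𝓕 g ξ := by
    intro h
    have h1 : 𝓕 (fun x => g (x + h)) ξ = (Real.fourierChar (inner ℝ h ξ) : ℂ) * 𝓕 g ξ := by
      have := VectorFourier.fourierIntegral_comp_add_right Real.fourierChar (volume : Measure V)
        (innerₗ V) g h
      exact congrFun this ξ
    have h2 : 𝓕 (diff h g) ξ = 𝓕 (fun x => g (x + h)) ξ - 𝓕 g ξ := by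
      simp only [Real.fourier_eq]
      rw [← integral_sub]
      · simp only [diff, smul_sub]
      · exact (Real.fourierIntegral_convergent_iff ξ).2 (hg.integrable.comp_add_right h)
      · exact (Real.fourierIntegral_convergent_iff ξ).2 hg.integrable
    rw [h2, h1]; ring
  calc 𝓕 (diffOp k g) ξ
      = ∫ x, ∫ h, (Real.fourierChar (-inner ℝ x ξ)) • (k h • diff h g x) := by
        rw [Real.fourier_eq]
        congr 1 with x
        simp only [diffOp, Circle.smul_def, integral_smul]
    _ = ∫ h, ∫ x, (Real.fourierChar (-inner ℝ x ξ)) • (k h • diff h g x) :=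
        integral_integral_swap hi.swap
    _ = ∫ h, (k h • ((Real.fourierChar (inner ℝ h ξ) : ℂ) - 1)) * 𝓕 g ξ := by
        congr 1 with h
        rw [smul_mul_assoc, ← hd h, Real.fourier_eq, ← integral_smul]
        congr 1 with x
        rw [smul_comm]
    _ = symbol k ξ * 𝓕 g ξ := by rw [integral_mul_const, symbol]

/-- The Fourier transform is injective on `L¹`. -/
theorem ae_eq_zero_of_fourier_eq_zero {g : V → ℂ} (hg : Integrable g) (h0 : ∀ ξ, 𝓕 g ξ = 0) :
    g =ᵐ[volume] 0 := by
  refine ae_eq_zero_of_integral_contDiff_smul_eq_zero hg.locallyIntegrable fun φ hφ hs => ?_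
  set φc : V → ℂ := fun x => φ x with hφc
  have hφc1 : ContDiff ℝ (⊤ : ℕ∞) φc := Complex.ofRealCLM.contDiff.comp hφ
  have hφc2 : HasCompactSupport φc := hs.comp_left (g := fun t : ℝ => (t : ℂ)) (by simp)
  -- Writing the test function as the Fourier transform of ψ, the multiplication formula moves the
  -- transform onto g, where it vanishes.
  set ψ : SchwartzMap V ℂ := 𝓕⁻ (hφc2.toSchwartzMap hφc1) with hψ
  have h1 : 𝓕 ψ = hφc2.toSchwartzMap hφc1 := by simp [hψ]
  have h2 := VectorFourier.integral_fourierIntegral_smul_eq_flip (f := (ψ : V → ℂ)) (g := g)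
    (μ := volume) (ν := volume) (L := innerₗ V) Real.continuous_fourierChar
    (by exact continuous_inner) ψ.integrable hg
  have h3 : ∀ ξ, VectorFourier.fourierIntegral Real.fourierChar volume (innerₗ V) (ψ : V → ℂ) ξ
      = φ ξ := by
    intro ξ
    have : 𝓕 (ψ : V → ℂ) ξ = (𝓕 ψ) ξ := by rw [SchwartzMap.fourier_coe]
    change 𝓕 (ψ : V → ℂ) ξ = φ ξ
    rw [this, h1]
    rfl
  have h4 : ∀ ξ, VectorFourier.fourierIntegral Real.fourierChar volume (innerₗ V).flip g ξ = 0 := by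
    intro ξ
    rw [flip_innerₗ]
    exact h0 ξ
  simp only [h3, h4, smul_zero, integral_zero] at h2
  simpa using h2

end FracBV

namespace FracBV

open Metric Filter Topology FourierTransform Module

set_option linter.unusedSectionVars false

variable {V : Type*} [NormedAddCommGroup V] [InnerProductSpace ℝ V] [FiniteDimensional ℝ V]
  [MeasurableSpace V] [BorelSpace V]

/-! ### Riesz kernels -/

/-- The kernel `|h|^{-(d + s)}` of the fractional Laplacian of order `s`. -/
noncomputable def powerKernel (s : ℝ) (h : V) : ℝ := ‖h‖ ^ (-((finrank ℝ V : ℝ) + s))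

/-- The kernel `⟨v, h⟩ |h|^{-(d + α + 1)}` of the fractional derivative of order `α`
in direction `v`. -/
noncomputable def rieszKernel (α : ℝ) (v h : V) : ℝ :=
  inner ℝ v h / ‖h‖ ^ ((finrank ℝ V : ℝ) + α + 1)

theorem isLevyKernel_powerKernel [Nontrivial V] {s : ℝ} (hs0 : 0 < s) (hs1 : s < 1) :
    IsLevyKernel (powerKernel s : V → ℝ) := by
  refine ⟨by unfold powerKernel; fun_prop, ?_⟩
  have hd : 1 ≤ finrank ℝ V := finrank_pos
  refine (integrable_fun_norm_addHaar (volume : Measure V)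
    (f := fun r : ℝ => r ^ (-((finrank ℝ V : ℝ) + s)) * min 1 r)).2 ?_
  -- In polar coordinates the integrand is y^(-1-s) min(1, y): s < 1 gives convergence at 0, and s >
  -- 0 at infinity.
  have e : ∀ y ∈ Set.Ioi (0 : ℝ), y ^ (-1 - s) * min 1 y =
      y ^ (finrank ℝ V - 1) • (y ^ (-((finrank ℝ V : ℝ) + s)) * min 1 y) := by
    intro y hy
    rw [smul_eq_mul, ← mul_assoc, ← Real.rpow_natCast, ← Real.rpow_add hy, Nat.cast_sub hd]
    congr 2
    push_cast; ring
  refine IntegrableOn.congr_fun ?_ e measurableSet_Ioi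
  rw [← Set.Ioc_union_Ioi_eq_Ioi zero_le_one]
  refine IntegrableOn.union ?_ ?_
  · have h1 : IntegrableOn (fun y : ℝ => y ^ (-s)) (Set.Ioc 0 1) :=
      (intervalIntegrable_iff_integrableOn_Ioc_of_le zero_le_one).1
        (intervalIntegral.intervalIntegrable_rpow' (by linarith))
    refine h1.congr_fun (fun y hy => ?_) measurableSet_Ioc
    simp only
    rw [min_eq_right hy.2, ← Real.rpow_add_one hy.1.ne']
    congr 1; ring
  · refine (integrableOn_Ioi_rpow_of_lt (a := -1 - s) (by linarith) one_pos).congr_fun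
      (fun y hy => ?_) measurableSet_Ioi
    simp only
    rw [min_eq_left (le_of_lt hy), mul_one]

theorem abs_rieszKernel_le (α : ℝ) (v h : V) :
    |rieszKernel α v h| ≤ ‖v‖ * powerKernel α h := by
  rcases eq_or_ne h 0 with rfl | hh
  · simp only [rieszKernel, inner_zero_right, zero_div, abs_zero, powerKernel]
    positivity
  · have h0 : 0 < ‖h‖ := norm_pos_iff.2 hh
    rw [rieszKernel, abs_div, abs_of_pos (Real.rpow_pos_of_pos h0 _), powerKernel,
      Real.rpow_neg h0.le, ← div_eq_mul_inv, Real.rpow_add_one h0.ne', mul_comm _ ‖h‖,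
      div_le_div_iff₀ (by positivity) (by positivity)]
    calc |inner ℝ v h| * ‖h‖ ^ ((finrank ℝ V : ℝ) + α)
        ≤ ‖v‖ * ‖h‖ * ‖h‖ ^ ((finrank ℝ V : ℝ) + α) := by
          gcongr; exact abs_real_inner_le_norm v h
      _ = ‖v‖ * (‖h‖ * ‖h‖ ^ ((finrank ℝ V : ℝ) + α)) := by ring

theorem isLevyKernel_rieszKernel [Nontrivial V] {α : ℝ} (hα0 : 0 < α) (hα1 : α < 1) (v : V) :
    IsLevyKernel (rieszKernel α v) := by
  have hm : Measurable (rieszKernel α v) := by unfold rieszKernel; fun_prop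
  refine ⟨hm, ((isLevyKernel_powerKernel hα0 hα1).integrable.const_mul ‖v‖).mono'
    (hm.mul (by fun_prop)).aestronglyMeasurable (.of_forall fun h => ?_)⟩
  rw [norm_mul, Real.norm_of_nonneg (min_one_norm_nonneg h), ← mul_assoc]
  exact mul_le_mul_of_nonneg_right (abs_rieszKernel_le α v h) (min_one_norm_nonneg h)

theorem powerKernel_smul (s : ℝ) {r : ℝ} (hr : 0 < r) (h : V) :
    powerKernel s (r • h) = r ^ (-((finrank ℝ V : ℝ) + s)) * powerKernel s h := by
  rw [powerKernel, norm_smul, Real.norm_of_nonneg hr.le,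
    Real.mul_rpow hr.le (norm_nonneg _), powerKernel]

theorem rieszKernel_smul (α : ℝ) {r : ℝ} (hr : 0 < r) (v h : V) :
    rieszKernel α v (r • h) = r ^ (-((finrank ℝ V : ℝ) + α)) * rieszKernel α v h := by
  rw [rieszKernel, norm_smul, Real.norm_of_nonneg hr.le,
    Real.mul_rpow hr.le (norm_nonneg _), rieszKernel, inner_smul_right, Real.rpow_neg hr.le,
    Real.rpow_add_one hr.ne']
  field_simp

theorem rieszKernel_isometry (α : ℝ) (A : V ≃ₗᵢ[ℝ] V) (v h : V) :
    rieszKernel α (A v) (A h) = rieszKernel α v h := by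
  simp [rieszKernel]

/-! ### Symbols of the Riesz kernels -/

theorem integrable_symbol {k : V → ℝ} (hk : IsLevyKernel k) (ξ : V) :
    Integrable fun h => k h • ((Real.fourierChar (inner ℝ h ξ) : ℂ) - 1) := by
  have hm : AEStronglyMeasurable (fun h : V => k h • ((Real.fourierChar (inner ℝ h ξ) : ℂ) - 1)) := by
    have : Continuous fun h : V => (Real.fourierChar (inner ℝ h ξ) : ℂ) - 1 := by
      have := Real.continuous_fourierChar
      fun_prop
    exact hk.measurable.aestronglyMeasurable.smul this.aestronglyMeasurable
  refine (hk.integrable.norm.const_mul (2 + 2 * Real.pi * ‖ξ‖)).mono' hm (.of_forall fun h => ?_)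
  rw [norm_smul, norm_mul, Real.norm_of_nonneg (min_one_norm_nonneg h)]
  have hb : ‖(Real.fourierChar (inner ℝ h ξ) : ℂ) - 1‖ ≤
      (2 + 2 * Real.pi * ‖ξ‖) * min 1 ‖h‖ := by
    have hπ := Real.pi_pos
    rcases le_total 1 ‖h‖ with h1 | h1
    · rw [min_eq_left h1]
      refine (norm_sub_le _ _).trans ?_
      rw [Circle.norm_coe, norm_one]
      nlinarith [mul_nonneg hπ.le (norm_nonneg ξ)]
    · rw [min_eq_right h1, Real.fourierChar_apply, mul_comm]
      refine Real.norm_exp_I_mul_ofReal_sub_one_le.trans ?_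
      rw [norm_mul, Real.norm_of_nonneg (by positivity)]
      have h2 : ‖inner ℝ h ξ‖ ≤ ‖h‖ * ‖ξ‖ := norm_inner_le_norm h ξ
      calc 2 * Real.pi * ‖inner ℝ h ξ‖ ≤ 2 * Real.pi * (‖h‖ * ‖ξ‖) := by gcongr
        _ ≤ (2 + 2 * Real.pi * ‖ξ‖) * ‖h‖ := by nlinarith [norm_nonneg h]
  calc ‖k h‖ * _ ≤ ‖k h‖ * ((2 + 2 * Real.pi * ‖ξ‖) * min 1 ‖h‖) := by gcongr
    _ = _ := by ring

@[simp] theorem symbol_zero_right (k : V → ℝ) : symbol k 0 = 0 := by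
  simp [symbol]

theorem symbol_isometry (k : V → ℝ) (A : V ≃ₗᵢ[ℝ] V) (ξ : V) :
    symbol (fun h => k (A h)) ξ = symbol k (A ξ) := by
  have := A.measurePreserving.integral_comp A.toHomeomorph.measurableEmbedding
    fun h => k h • ((Real.fourierChar (inner ℝ h (A ξ)) : ℂ) - 1)
  simpa [symbol] using this

/-- Substitute u = r h: homogeneity of the kernel contributes r^(d+s) and the Jacobian r^(-d). -/
theorem symbol_smul {k : V → ℝ} {s : ℝ}
    (hk : ∀ r : ℝ, 0 < r → ∀ h, k (r • h) = r ^ (-((finrank ℝ V : ℝ) + s)) * k h)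
    {r : ℝ} (hr : 0 < r) (ξ : V) : symbol k (r • ξ) = ((r ^ s : ℝ) : ℂ) * symbol k ξ := by
  have h1 : symbol k (r • ξ) = ∫ h, (fun u : V => (r ^ ((finrank ℝ V : ℝ) + s)) •
      (k u • ((Real.fourierChar (inner ℝ u ξ) : ℂ) - 1))) (r • h) := by
    rw [symbol]
    congr 1 with h
    simp only
    rw [hk r hr, real_inner_smul_right, real_inner_smul_left, smul_smul, ← mul_assoc,
      ← Real.rpow_add hr, add_neg_cancel, Real.rpow_zero, one_mul]
  have h2 := Measure.integral_comp_smul (volume : Measure V) (fun u : V =>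
    (r ^ ((finrank ℝ V : ℝ) + s)) • (k u • ((Real.fourierChar (inner ℝ u ξ) : ℂ) - 1))) r
  rw [h1]
  refine h2.trans ?_
  rw [integral_smul, smul_smul, ← symbol, abs_of_pos (by positivity), Real.rpow_add hr, Real.rpow_natCast, ← Complex.real_smul]
  congr 1
  field_simp

theorem exists_symbol_powerKernel [Nontrivial V] {s : ℝ} (hs : 0 < s) :
    ∃ C : ℂ, ∀ ξ : V, symbol (powerKernel s) ξ = ((‖ξ‖ ^ s : ℝ) : ℂ) * C := by
  obtain ⟨e, he⟩ := exists_norm_eq V zero_le_one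
  refine ⟨symbol (powerKernel s) e, fun ξ => ?_⟩
  rcases eq_or_ne ξ 0 with rfl | hξ
  · simp [Real.zero_rpow hs.ne']
  have hr : 0 < ‖ξ‖ := norm_pos_iff.2 hξ
  set η := ‖ξ‖⁻¹ • ξ with hη
  have hη1 : ‖e‖ = ‖η‖ := by rw [he, hη, norm_smul]; simp [hr.ne']
  have h1 : ξ = ‖ξ‖ • η := by rw [hη, smul_smul, mul_inv_cancel₀ hr.ne', one_smul]
  -- The reflection in the hyperplane orthogonal to e - η carries one unit vector to the other.
  have h2 : symbol (powerKernel s) η = symbol (powerKernel s) e := by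
    rw [← Submodule.reflection_sub hη1, ← symbol_isometry]
    congr 1 with h
    simp only [powerKernel, LinearIsometryEquiv.norm_map]
  conv_lhs => rw [h1, symbol_smul (fun r hr h => powerKernel_smul s hr h) hr, h2]

theorem symbol_rieszKernel_isometry (α : ℝ) (A : V ≃ₗᵢ[ℝ] V) (v ξ : V) :
    symbol (rieszKernel α (A v)) (A ξ) = symbol (rieszKernel α v) ξ := by
  rw [← symbol_isometry]
  simp only [rieszKernel_isometry]

theorem symbol_rieszKernel_smul_left (α c : ℝ) (v ξ : V) :
    symbol (rieszKernel α (c • v)) ξ = (c : ℂ) * symbol (rieszKernel α v) ξ := by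
  simp only [symbol, rieszKernel, inner_smul_left, ← Complex.real_smul]
  rw [← integral_smul]
  congr 1 with h
  rw [smul_smul, mul_div_assoc]
  rfl

theorem symbol_rieszKernel_add_left [Nontrivial V] {α : ℝ} (hα0 : 0 < α) (hα1 : α < 1)
    (v w ξ : V) : symbol (rieszKernel α (v + w)) ξ =
      symbol (rieszKernel α v) ξ + symbol (rieszKernel α w) ξ := by
  simp only [symbol]
  rw [← integral_add (integrable_symbol (isLevyKernel_rieszKernel hα0 hα1 v) ξ)
    (integrable_symbol (isLevyKernel_rieszKernel hα0 hα1 w) ξ)]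
  congr 1 with h
  rw [← add_smul, rieszKernel, inner_add_left, add_div]
  rfl

/-- The reflection in the hyperplane orthogonal to u fixes ξ and negates u, so the symbol equals its
own negative. -/
theorem symbol_rieszKernel_of_orthogonal (α : ℝ) {u ξ : V} (h : inner ℝ u ξ = 0) :
    symbol (rieszKernel α u) ξ = 0 := by
  have h1 := symbol_rieszKernel_isometry α (ℝ ∙ u)ᗮ.reflection u ξ
  rw [Submodule.reflection_orthogonalComplement_singleton_eq_neg,
    Submodule.reflection_mem_subspace_eq_self
      (Submodule.mem_orthogonal_singleton_iff_inner_right.2 h), ← neg_one_smul ℝ u,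
    symbol_rieszKernel_smul_left] at h1
  push_cast at h1
  linear_combination (-1 / 2 : ℂ) * h1

theorem exists_symbol_rieszKernel [Nontrivial V] {α : ℝ} (hα0 : 0 < α) (hα1 : α < 1) :
    ∃ C : ℂ, ∀ v ξ : V,
      symbol (rieszKernel α v) ξ = ((inner ℝ v ξ * ‖ξ‖ ^ (α - 1) : ℝ) : ℂ) * C := by
  obtain ⟨e, he⟩ := exists_norm_eq V zero_le_one
  refine ⟨symbol (rieszKernel α e) e, fun v ξ => ?_⟩
  rcases eq_or_ne ξ 0 with rfl | hξ
  · simp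
  have hr : 0 < ‖ξ‖ := norm_pos_iff.2 hξ
  set η := ‖ξ‖⁻¹ • ξ with hη
  have hη1 : ‖e‖ = ‖η‖ := by rw [he, hη, norm_smul]; simp [hr.ne']
  have h1 : ξ = ‖ξ‖ • η := by rw [hη, smul_smul, mul_inv_cancel₀ hr.ne', one_smul]
  have h2 : symbol (rieszKernel α η) η = symbol (rieszKernel α e) e := by
    rw [← Submodule.reflection_sub hη1, symbol_rieszKernel_isometry]
  have h3 : symbol (rieszKernel α η) ξ = ((‖ξ‖ ^ α : ℝ) : ℂ) * symbol (rieszKernel α e) e := by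
    conv_lhs => rw [h1, symbol_smul (fun r hr h => rieszKernel_smul α hr η h) hr, h2]
  -- Split v into c η and a part orthogonal to ξ. The latter contributes nothing, and the former is
  -- fixed by isometry invariance and homogeneity.
  set c := inner ℝ v η with hc
  have h4 : inner ℝ (v - c • η) ξ = 0 := by
    rw [h1, inner_smul_right, inner_sub_left, real_inner_smul_left, real_inner_self_eq_norm_sq,
      ← hη1, he, hc]
    simp
  have h5 : symbol (rieszKernel α v) ξ = (c : ℂ) * symbol (rieszKernel α η) ξ := by
    conv_lhs => rw [← add_sub_cancel (c • η) v]
    rw [symbol_rieszKernel_add_left hα0 hα1, symbol_rieszKernel_of_orthogonal α h4,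
      symbol_rieszKernel_smul_left, add_zero]
  have h6 : inner ℝ v ξ * ‖ξ‖ ^ (α - 1) = c * ‖ξ‖ ^ α := by
    conv_lhs => rw [h1, inner_smul_right, ← hc, ← h1]
    rw [Real.rpow_sub_one hr.ne']
    field_simp
  rw [h5, h3, h6]
  push_cast; ring

/-! ### Nonvanishing of symbols and factorization of the partial derivatives -/

theorem ofReal_diffOp (k : V → ℝ) (g : V → ℝ) :
    (fun x => ((diffOp k g x : ℝ) : ℂ)) = diffOp k fun x => (g x : ℂ) := by
  ext x
  rw [diffOp, diffOp, ← integral_complex_ofReal]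
  congr 1 with h
  simp [diff]

/-- If the symbol vanished identically, `diffOp k φ` would vanish a.e. for a bump φ centred at e.
But for x near 0 one has φ(x) = 0, while φ(x + h) is nonzero only where k(h) > 0, so the integral is
strictly positive. -/
theorem exists_symbol_ne_zero {k : V → ℝ} (hk : IsLevyKernel k) {e : V} {ρ : ℝ} (hρ : 0 < ρ)
    (hρe : ρ ≤ ‖e‖) (hpos : ∀ h ∈ ball e ρ, 0 < k h) : ∃ ξ, symbol k ξ ≠ 0 := by
  by_contra! h0
  let φ : ContDiffBump e := ⟨ρ / 4, ρ / 2, by linarith, by linarith⟩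
  set φc : V → ℂ := fun x => (φ x : ℂ) with hφc
  have hφ1 : ContDiff ℝ 2 φc := Complex.ofRealCLM.contDiff.comp φ.contDiff
  have hφ2 : HasCompactSupport φc :=
    φ.hasCompactSupport.comp_left (g := fun t : ℝ => (t : ℂ)) (by simp)
  have hL := isL1Lipschitz_of_contDiff hφ1 hφ2
  have hae := ae_eq_zero_of_fourier_eq_zero (integrable_diffOp hk hL) fun ξ => by
    rw [fourier_diffOp hk hL, h0, zero_mul]
  have hLr : IsL1Lipschitz φ := isL1Lipschitz_of_contDiff φ.contDiff φ.hasCompactSupport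
  have hint := ae_integrable_diff hk hLr
  -- Convergence at x is kept along with the vanishing: a divergent integral would also be 0 by
  -- convention.
  obtain ⟨x, hx, hx0, hxi⟩ : ∃ x ∈ ball (0 : V) (ρ / 2),
      diffOp k φ x = 0 ∧ Integrable fun h => k h • diff h φ x := by
    have hb : volume (ball (0 : V) (ρ / 2)) ≠ 0 := (measure_ball_pos _ _ (by linarith)).ne'
    have : ∀ᵐ x : V, diffOp k φ x = 0 ∧ Integrable fun h => k h • diff h φ x := by
      filter_upwards [hae, hint] with x h1 h2
      refine ⟨?_, h2⟩
      rw [← ofReal_diffOp] at h1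
      simpa using h1
    have h3 : ∃ᵐ x : V, x ∈ ball (0 : V) (ρ / 2) := by
      rw [frequently_ae_mem_iff]; exact hb
    obtain ⟨x, h1, h2⟩ := (h3.and_eventually this).exists
    exact ⟨x, h1, h2⟩
  rw [mem_ball_zero_iff] at hx
  -- The bump has outer radius ρ/2 and ‖x‖ < ρ/2, while ‖e‖ ≥ ρ keeps x outside its support.
  have hφx : φ x = 0 := by
    refine φ.zero_of_le_dist ?_
    change ρ / 2 ≤ dist x e
    rw [dist_eq_norm]
    have := norm_sub_norm_le e x
    rw [norm_sub_rev] at this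
    linarith
  have hsub : ∀ h, x + h ∈ ball e (ρ / 2) → h ∈ ball e ρ := by
    intro h hh
    rw [mem_ball_iff_norm] at hh ⊢
    calc ‖h - e‖ = ‖(x + h - e) - x‖ := by congr 1; abel
      _ ≤ ‖x + h - e‖ + ‖x‖ := norm_sub_le _ _
      _ < ρ := by linarith
  have hnn : ∀ h, 0 ≤ k h • diff h φ x := by
    intro h
    rw [diff, hφx, sub_zero, smul_eq_mul]
    by_cases hh : x + h ∈ ball e (ρ / 2)
    · exact mul_nonneg (hpos h (hsub h hh)).le φ.nonneg
    · rw [φ.zero_of_le_dist (by simpa using hh), mul_zero]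
  have hz := (integral_eq_zero_iff_of_nonneg hnn hxi).1 hx0
  have hb : volume (ball (e - x) (ρ / 2)) ≠ 0 := (measure_ball_pos _ _ (by linarith)).ne'
  obtain ⟨h, h1, h2⟩ := ((frequently_ae_mem_iff.2 hb).and_eventually hz).exists
  have h3 : x + h ∈ ball e (ρ / 2) := by
    rw [mem_ball_iff_norm] at h1 ⊢
    convert h1 using 2; abel
  have h4 : 0 < k h • diff h φ x := by
    rw [diff, hφx, sub_zero, smul_eq_mul]
    exact mul_pos (hpos h (hsub h h3)) (φ.pos_of_mem_ball h3)
  exact h4.ne' h2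

/-- The composition of a fractional Laplacian with a fractional derivative is a nonzero multiple
of a partial derivative. -/
theorem exists_diffOp_diffOp_eq [Nontrivial V] {α : ℝ} (hα0 : 0 < α) (hα1 : α < 1) :
    ∃ c : ℂ, c ≠ 0 ∧ ∀ (v : V) (φ : V → ℝ), ContDiff ℝ 2 φ → HasCompactSupport φ →
      ∀ᵐ x, (fderiv ℝ φ x v : ℂ) =
        c * ((diffOp (powerKernel (1 - α)) (diffOp (rieszKernel α v) φ) x : ℝ) : ℂ) := by
  obtain ⟨C, hC⟩ := exists_symbol_rieszKernel (V := V) hα0 hα1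
  obtain ⟨C', hC'⟩ := exists_symbol_powerKernel (V := V) (s := 1 - α) (by linarith)
  obtain ⟨e, he⟩ := exists_norm_eq V zero_le_one
  have hkp : IsLevyKernel (powerKernel (1 - α) : V → ℝ) :=
    isLevyKernel_powerKernel (by linarith) (by linarith)
  have hball : ∀ h ∈ ball e (1 / 2), 0 < ‖h‖ ∧ 0 < inner ℝ e h := by
    intro h hh
    rw [mem_ball_iff_norm] at hh
    have h1 : |inner ℝ e (h - e)| ≤ ‖e‖ * ‖h - e‖ := abs_real_inner_le_norm _ _
    rw [inner_sub_right, real_inner_self_eq_norm_sq, he, one_mul, abs_le] at h1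
    have h2 : 0 < inner ℝ e h := by linarith [h1.1]
    refine ⟨norm_pos_iff.2 fun h0 => ?_, h2⟩
    rw [h0, inner_zero_right] at h2
    exact h2.false
  have hC0 : C ≠ 0 := by
    rintro rfl
    obtain ⟨ξ, hξ⟩ := exists_symbol_ne_zero (isLevyKernel_rieszKernel hα0 hα1 e)
      (e := e) one_half_pos (by rw [he]; norm_num)
      (fun h hh => div_pos (hball h hh).2 (Real.rpow_pos_of_pos (hball h hh).1 _))
    exact hξ (by rw [hC, mul_zero])
  have hC0' : C' ≠ 0 := by
    rintro rfl
    obtain ⟨ξ, hξ⟩ := exists_symbol_ne_zero hkp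
      (e := e) one_half_pos (by rw [he]; norm_num)
      (fun h hh => Real.rpow_pos_of_pos (hball h hh).1 _)
    exact hξ (by rw [hC', mul_zero])
  -- The symbol of the derivative is 2πi⟨v, ξ⟩, and that of the composition is C C'⟨v, ξ⟩.
  refine ⟨2 * Real.pi * Complex.I / (C * C'), by simp [hC0, hC0', Real.pi_ne_zero],
    fun v φ hφ hs => ?_⟩
  set φc : V → ℂ := fun x => (φ x : ℂ) with hφc
  have hφ1 : ContDiff ℝ 2 φc := Complex.ofRealCLM.contDiff.comp hφ
  have hφ2 : HasCompactSupport φc := hs.comp_left (g := fun t : ℝ => (t : ℂ)) (by simp)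
  have hkr := isLevyKernel_rieszKernel hα0 hα1 v
  have hL := isL1Lipschitz_of_contDiff hφ1 hφ2
  have hL' := isL1Lipschitz_diffOp hkr hφ1 hφ2
  have hdi : Integrable (fderiv ℝ φc) :=
    (hφ1.continuous_fderiv (by norm_num)).integrable_of_hasCompactSupport (hφ2.fderiv (𝕜 := ℝ))
  have hfd : ∀ ξ, 𝓕 (fun x => fderiv ℝ φc x v) ξ =
      2 * Real.pi * Complex.I * (inner ℝ v ξ : ℝ) * 𝓕 φc ξ := by
    intro ξ
    rw [← Real.fourier_continuousLinearMap_apply hdi,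
      Real.fourier_fderiv hL.integrable (hφ1.differentiable (by norm_num)) hdi,
      VectorFourier.fourierSMulRight_apply]
    have h1 : ((-innerSL ℝ : V →L[ℝ] V →L[ℝ] ℝ) ξ) v = -inner ℝ v ξ := by
      rw [real_inner_comm]; rfl
    rw [h1, Complex.real_smul, smul_eq_mul]
    push_cast; ring
  have hsym : ∀ ξ : V, symbol (powerKernel (1 - α)) ξ * symbol (rieszKernel α v) ξ =
      (inner ℝ v ξ : ℝ) * (C * C') := by
    intro ξ
    -- At ξ = 0 the powers do not multiply to 1, but both sides vanish.
    rcases eq_or_ne ξ 0 with rfl | hξ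
    · simp
    have hr : 0 < ‖ξ‖ := norm_pos_iff.2 hξ
    have h1 : ‖ξ‖ ^ (1 - α) * ‖ξ‖ ^ (α - 1) = 1 := by
      rw [← Real.rpow_add hr]; simp
    have h2 : ((‖ξ‖ ^ (1 - α) : ℝ) : ℂ) * ((‖ξ‖ ^ (α - 1) : ℝ) : ℂ) = 1 := by
      rw [← Complex.ofReal_mul, h1, Complex.ofReal_one]
    rw [hC, hC', Complex.ofReal_mul]
    linear_combination ((inner ℝ v ξ : ℝ) * C * C' : ℂ) * h2
  set c : ℂ := 2 * Real.pi * Complex.I / (C * C') with hc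
  have hTi := integrable_diffOp hkp hL'
  have hdi' : Integrable fun x => fderiv ℝ φc x v := hdi.apply_continuousLinearMap v
  have hae := ae_eq_zero_of_fourier_eq_zero
    (g := fun x => fderiv ℝ φc x v - c * diffOp (powerKernel (1 - α)) (diffOp (rieszKernel α v) φc) x)
    (hdi'.sub (hTi.const_mul c)) fun ξ => by
      have h1 : 𝓕 (fun x => fderiv ℝ φc x v -
          c * diffOp (powerKernel (1 - α)) (diffOp (rieszKernel α v) φc) x) ξ =
          𝓕 (fun x => fderiv ℝ φc x v) ξ -
            c * 𝓕 (diffOp (powerKernel (1 - α)) (diffOp (rieszKernel α v) φc)) ξ := by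
        simp only [Real.fourier_eq]
        rw [← integral_const_mul, ← integral_sub]
        · simp only [smul_sub, mul_smul_comm]
        · exact (Real.fourierIntegral_convergent_iff ξ).2 hdi'
        · exact ((Real.fourierIntegral_convergent_iff ξ).2 hTi).const_mul c
      rw [h1, hfd, fourier_diffOp hkp hL', fourier_diffOp hkr hL, ← mul_assoc (symbol _ _), hsym, hc]
      field_simp
      ring
  filter_upwards [hae] with x hx
  have h1 : fderiv ℝ φc x v = (fderiv ℝ φ x v : ℂ) := by
    have := (Complex.ofRealCLM.hasFDerivAt.comp x
      (hφ.differentiable (by norm_num) x).hasFDerivAt).fderiv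
    have h2 : fderiv ℝ φc x = _ := this
    rw [h2]; rfl
  have h2 := congrFun (ofReal_diffOp (powerKernel (1 - α)) (diffOp (rieszKernel α v) φ)) x
  rw [ofReal_diffOp] at h2
  simp only [Pi.zero_apply] at hx
  rw [h1] at hx
  rw [h2, ← sub_eq_zero, hx]

/-! ### Vanishing of the fractional derivative and of the derivative -/

theorem integral_mul_fderiv_eq_zero [Nontrivial V] {α : ℝ} (hα0 : 0 < α) (hα1 : α < 1)
    {f : V → ℝ} (hf : MemLp f ∞ volume) {v : V}
    (h0 : ∀ φ : V → ℝ, ContDiff ℝ (⊤ : ℕ∞) φ → HasCompactSupport φ →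
      ∫ x, f x * diffOp (rieszKernel α v) φ x = 0)
    {φ : V → ℝ} (hφ : ContDiff ℝ (⊤ : ℕ∞) φ) (hs : HasCompactSupport φ) :
    ∫ x, f x * fderiv ℝ φ x v = 0 := by
  have hφ2 : ContDiff ℝ 2 φ := mod_cast contDiff_infty.1 hφ 2
  obtain ⟨c, -, hc⟩ := exists_diffOp_diffOp_eq (V := V) hα0 hα1
  have hkr := isLevyKernel_rieszKernel hα0 hα1 v
  have h1 : ∫ x, f x * diffOp (powerKernel (1 - α)) (diffOp (rieszKernel α v) φ) x = 0 := by
    rw [integral_mul_diffOp (isLevyKernel_powerKernel (by linarith) (by linarith))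
      (isL1Lipschitz_diffOp hkr hφ2 hs) hf]
    refine integral_eq_zero_of_ae (.of_forall fun h => ?_)
    -- Commuting the difference past the fractional derivative brings the integral back to the
    -- hypothesis for the test function `diff h φ`.
    have h2 : ∫ x, f x * diff h (diffOp (rieszKernel α v) φ) x = 0 := by
      rw [← h0 (diff h φ) ((hφ.comp (contDiff_id.add contDiff_const)).sub hφ)
        ((hs.comp_homeomorph (Homeomorph.addRight h)).sub hs)]
      refine integral_congr_ae ?_
      filter_upwards [diff_diffOp hkr (isL1Lipschitz_of_contDiff hφ2 hs) h] with x hx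
      rw [hx]
    simp [h2]
  have h2 : ((∫ x, f x * fderiv ℝ φ x v : ℝ) : ℂ) =
      c * ((∫ x, f x * diffOp (powerKernel (1 - α)) (diffOp (rieszKernel α v) φ) x : ℝ) : ℂ) := by
    rw [← integral_complex_ofReal, ← integral_complex_ofReal, ← integral_const_mul]
    refine integral_congr_ae ?_
    filter_upwards [hc v φ hφ2 hs] with x hx
    push_cast
    rw [hx]; ring
  rw [h1] at h2
  simpa using h2

theorem integral_mul_comp_add_smul {f : V → ℝ} (hf : MemLp f ∞ volume) {v : V}
    (h0 : ∀ φ : V → ℝ, ContDiff ℝ (⊤ : ℕ∞) φ → HasCompactSupport φ →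
      ∫ x, f x * fderiv ℝ φ x v = 0)
    {φ : V → ℝ} (hφ : ContDiff ℝ (⊤ : ℕ∞) φ) (hs : HasCompactSupport φ) (h : V) (t : ℝ) :
    ∫ x, f x * φ (x + (h + t • v)) = ∫ x, f x * φ (x + h) := by
  -- With f reflected, z ↦ ∫ f(x) φ(x + z) dx is a convolution, and its derivatives fall on φ. The
  -- derivative along v is then zero by `h0` applied to a translate of φ.
  set f' : V → ℝ := fun x => f (-x)
  have hf' : LocallyIntegrable f' := by
    have : MemLp f' ∞ volume := hf.comp_measurePreserving (Measure.measurePreserving_neg volume)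
    exact this.locallyIntegrable le_top
  have hconv : ∀ (ψ : V → ℝ) (z : V),
      convolution f' ψ (ContinuousLinearMap.mul ℝ ℝ) volume z = ∫ x, f x * ψ (x + z) := by
    intro ψ z
    rw [convolution_def, ← integral_neg_eq_self]
    congr 1 with x
    simp [f', add_comm]
  have hd := hs.hasFDerivAt_convolution_right (ContinuousLinearMap.mul ℝ ℝ) hf'
    (hφ.of_le (by exact_mod_cast le_top))
  have hline : ∀ s : ℝ, HasDerivAt (fun s : ℝ => convolution f' φ (ContinuousLinearMap.mul ℝ ℝ)
      volume (h + s • v)) 0 s := by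
    intro s
    have h1 : HasDerivAt (fun s : ℝ => h + s • v) v s := by
      simpa using ((hasDerivAt_id s).smul_const v).const_add h
    have h2 := (hd (h + s • v)).comp_hasDerivAt s h1
    rw [convolution_precompR_apply _ hf' (hs.fderiv (𝕜 := ℝ))
      (hφ.continuous_fderiv (by simp)), hconv] at h2
    have h3 := h0 (fun x => φ (x + (h + s • v))) (hφ.comp (contDiff_id.add contDiff_const))
      (hs.comp_homeomorph (Homeomorph.addRight (h + s • v)))
    simp only [fderiv_comp_add_right] at h3
    rwa [h3] at h2
  have := is_const_of_deriv_eq_zero (fun s => (hline s).differentiableAt)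
    (fun s => (hline s).deriv) t 0
  simpa only [hconv, zero_smul, add_zero] using this

theorem rieszKernel_reflection (α : ℝ) (v h : V) :
    rieszKernel α v ((ℝ ∙ v)ᗮ.reflection h) = - rieszKernel α v h := by
  have h1 := rieszKernel_isometry α (ℝ ∙ v)ᗮ.reflection (-v) h
  rw [map_neg, Submodule.reflection_orthogonalComplement_singleton_eq_neg, neg_neg] at h1
  rw [h1, rieszKernel, rieszKernel, inner_neg_left, neg_div]

theorem integral_mul_diffOp_rieszKernel_eq_zero [Nontrivial V] {α : ℝ} (hα0 : 0 < α)
    (hα1 : α < 1) {f : V → ℝ} (hf : MemLp f ∞ volume) {v : V}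
    (h0 : ∀ φ : V → ℝ, ContDiff ℝ (⊤ : ℕ∞) φ → HasCompactSupport φ →
      ∫ x, f x * fderiv ℝ φ x v = 0)
    {φ : V → ℝ} (hφ : ContDiff ℝ (⊤ : ℕ∞) φ) (hs : HasCompactSupport φ) :
    ∫ x, f x * diffOp (rieszKernel α v) φ x = 0 := by
  have hi : ∀ h : V, Integrable fun x => f x * φ (x + h) := fun h =>
    ((hφ.continuous.integrable_of_hasCompactSupport hs).comp_add_right h).mul_of_top_right hf
  rw [integral_mul_diffOp (isLevyKernel_rieszKernel hα0 hα1 v)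
    (isL1Lipschitz_of_contDiff (mod_cast contDiff_infty.1 hφ 2) hs) hf]
  set R := (ℝ ∙ v)ᗮ.reflection with hR
  -- R h differs from h by a multiple of v, along which the pairing of f with translates of φ is
  -- constant.
  have hinv : ∀ h, ∫ x, f x * diff (R h) φ x = ∫ x, f x * diff h φ x := by
    intro h
    have h1 : R h = h + (-(2 * (inner ℝ v h / ‖v‖ ^ 2))) • v := by
      rw [hR, Submodule.reflection_orthogonal_apply, Submodule.reflection_singleton_apply]
      simp only [RCLike.ofReal_real_eq_id, id, neg_smul, mul_smul, two_smul]
      abel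
    -- The summand x + 0 puts both terms in the form covered by `hi`.
    have h2 : ∀ z, ∫ x, f x * diff z φ x = ∫ x, f x * φ (x + z) - f x * φ (x + 0) := by
      intro z
      simp [diff, mul_sub]
    rw [h2, h2, integral_sub (hi _) (hi _), integral_sub (hi _) (hi _), h1,
      integral_mul_comp_add_smul hf h0 hφ hs]
  have h3 := R.measurePreserving.integral_comp R.toHomeomorph.measurableEmbedding
    fun h => rieszKernel α v h * ∫ x, f x * diff h φ x
  simp only [hinv] at h3
  simp only [hR, rieszKernel_reflection, neg_mul, integral_neg] at h3
  linarith

end FracBV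

namespace FracBV

open Metric Filter Topology
open scoped NNReal CompactlySupported

/-! ### The Riesz representation theorem for functionals of locally bounded variation -/

section Riesz

variable {X : Type*} [TopologicalSpace X]

/-- The values of `L` on the functions between `0` and `u`. -/
def valuesBelow (L : C_c(X, ℝ) →ₗ[ℝ] ℝ) (u : C_c(X, ℝ≥0)) : Set ℝ :=
  {r | ∃ ψ : C_c(X, ℝ≥0), ψ ≤ u ∧ L ψ.toReal = r}

/-- The positive part of a linear functional, on nonnegative functions. -/
noncomputable def posPartFun (L : C_c(X, ℝ) →ₗ[ℝ] ℝ) (u : C_c(X, ℝ≥0)) : ℝ :=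
  sSup (valuesBelow L u)

variable (L : C_c(X, ℝ) →ₗ[ℝ] ℝ)

theorem toReal_zero : (0 : C_c(X, ℝ≥0)).toReal = 0 := by ext; simp

theorem zero_mem_valuesBelow (u : C_c(X, ℝ≥0)) : 0 ∈ valuesBelow L u :=
  ⟨0, fun x => by simp, by rw [toReal_zero, map_zero]⟩

open scoped Pointwise in
-- This is the Riesz decomposition property: ψ ≤ u + v splits into ψ ⊓ u and a remainder that lies
-- below v.
theorem valuesBelow_add (u v : C_c(X, ℝ≥0)) :
    valuesBelow L (u + v) = valuesBelow L u + valuesBelow L v := by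
  ext r
  rw [Set.mem_add]
  constructor
  · rintro ⟨ψ, hψ, rfl⟩
    obtain ⟨ψ', hψ'⟩ := CompactlySupportedContinuousMap.exists_add_of_le
      (inf_le_left : ψ ⊓ u ≤ ψ)
    refine ⟨_, ⟨ψ ⊓ u, inf_le_right, rfl⟩, _, ⟨ψ', fun x => ?_, rfl⟩, ?_⟩
    · have h1 : min (ψ x) (u x) + ψ' x = ψ x := DFunLike.congr_fun hψ' x
      have h2 : ψ x ≤ u x + v x := hψ x
      change ψ' x ≤ v x
      rw [← NNReal.coe_le_coe] at h2 ⊢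
      rw [← NNReal.coe_inj] at h1
      push_cast at h1 h2
      have h3 := (v x).coe_nonneg
      rcases min_cases (ψ x : ℝ) (u x) with h | h <;> linarith [h.1]
    · rw [← map_add, ← CompactlySupportedContinuousMap.toReal_add, hψ']
  · rintro ⟨_, ⟨ψ, hψ, rfl⟩, _, ⟨ψ', hψ', rfl⟩, rfl⟩
    refine ⟨ψ + ψ', fun x => add_le_add (hψ x) (hψ' x), ?_⟩
    rw [CompactlySupportedContinuousMap.toReal_add, map_add]

theorem map_toReal_smul (c : ℝ≥0) (u : C_c(X, ℝ≥0)) : L (c • u).toReal = c * L u.toReal := by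
  rw [CompactlySupportedContinuousMap.toReal_smul]
  exact L.map_smul (c : ℝ) _

open scoped Pointwise in
theorem valuesBelow_smul {c : ℝ≥0} (hc : c ≠ 0) (u : C_c(X, ℝ≥0)) :
    valuesBelow L (c • u) = (c : ℝ) • valuesBelow L u := by
  ext r
  rw [Set.mem_smul_set]
  constructor
  · rintro ⟨ψ, hψ, rfl⟩
    refine ⟨_, ⟨c⁻¹ • ψ, fun x => ?_, rfl⟩, ?_⟩
    · have : ψ x ≤ c * u x := hψ x
      change c⁻¹ * ψ x ≤ u x
      rwa [inv_mul_le_iff₀ (pos_iff_ne_zero.2 hc)]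
    · rw [map_toReal_smul, NNReal.coe_inv, smul_eq_mul, mul_inv_cancel_left₀]
      exact_mod_cast hc
  · rintro ⟨_, ⟨ψ, hψ, rfl⟩, rfl⟩
    refine ⟨c • ψ, fun x => ?_, by rw [map_toReal_smul]; rfl⟩
    exact mul_le_mul_right (hψ x) c

variable {L} (hL : ∀ u, BddAbove (valuesBelow L u))

include hL in
theorem posPartFun_add (u v : C_c(X, ℝ≥0)) :
    posPartFun L (u + v) = posPartFun L u + posPartFun L v := by
  rw [posPartFun, valuesBelow_add]
  exact csSup_add ⟨0, zero_mem_valuesBelow L u⟩ (hL u) ⟨0, zero_mem_valuesBelow L v⟩ (hL v)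

theorem posPartFun_smul (c : ℝ≥0) (u : C_c(X, ℝ≥0)) :
    posPartFun L (c • u) = c * posPartFun L u := by
  rcases eq_or_ne c 0 with rfl | hc
  · have : valuesBelow L 0 = {0} := by
      refine Set.eq_singleton_iff_unique_mem.2 ⟨zero_mem_valuesBelow L 0, ?_⟩
      rintro _ ⟨ψ, hψ, rfl⟩
      have : ψ = 0 := by
        ext x
        have : ψ x ≤ 0 := hψ x
        simpa using this
      rw [this, toReal_zero, map_zero]
    rw [zero_smul, posPartFun, this]
    simp
  · rw [posPartFun, valuesBelow_smul L hc, Real.sSup_smul_of_nonneg c.coe_nonneg]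
    rfl

include hL in
theorem posPartFun_nonneg (u : C_c(X, ℝ≥0)) : 0 ≤ posPartFun L u :=
  le_csSup (hL u) (zero_mem_valuesBelow L u)

include hL in
theorem le_posPartFun (u : C_c(X, ℝ≥0)) : L u.toReal ≤ posPartFun L u :=
  le_csSup (hL u) ⟨u, le_rfl, rfl⟩

theorem bddAbove_valuesBelow {L : C_c(X, ℝ) →ₗ[ℝ] ℝ}
    (hb : ∀ K, IsCompact K → ∃ C : ℝ,
      ∀ u : C_c(X, ℝ), tsupport u ⊆ K → ∀ M, (∀ x, |u x| ≤ M) → |L u| ≤ C * M)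
    (u : C_c(X, ℝ≥0)) : BddAbove (valuesBelow L u) := by
  obtain ⟨C, hC⟩ := hb (tsupport u) u.hasCompactSupport
  obtain ⟨M, hM⟩ := u.toReal.hasCompactSupport.exists_bound_of_continuous u.toReal.continuous
  refine ⟨C * M, ?_⟩
  rintro _ ⟨ψ, hψ, rfl⟩
  refine (le_abs_self _).trans (hC _ (closure_mono fun x hx => ?_) M fun x => ?_)
  · rw [Function.mem_support, CompactlySupportedContinuousMap.toReal_apply] at hx
    rw [Function.mem_support]
    contrapose! hx
    have h1 : ψ x ≤ u x := hψ x
    rw [hx] at h1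
    simpa using h1
  · have h1 := hM x
    rw [CompactlySupportedContinuousMap.toReal_apply, Real.norm_eq_abs,
      abs_of_nonneg (u x).coe_nonneg] at h1
    rw [CompactlySupportedContinuousMap.toReal_apply, abs_of_nonneg (ψ x).coe_nonneg]
    exact (NNReal.coe_le_coe.2 (hψ x)).trans h1

/-- A linear functional on `C_c(X, ℝ)` which is bounded on order intervals is a difference of
integrals. -/
theorem exists_measure_sub_measure [T2Space X] [LocallyCompactSpace X] [MeasurableSpace X]
    [BorelSpace X] (L : C_c(X, ℝ) →ₗ[ℝ] ℝ) (hL : ∀ u, BddAbove (valuesBelow L u)) :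
    ∃ μ ν : Measure X, IsFiniteMeasureOnCompacts μ ∧ IsFiniteMeasureOnCompacts ν ∧
      ∀ u : C_c(X, ℝ), L u = ∫ x, u x ∂μ - ∫ x, u x ∂ν := by
  let P : C_c(X, ℝ≥0) →ₗ[ℝ≥0] ℝ≥0 :=
    { toFun := fun u => ⟨posPartFun L u, posPartFun_nonneg hL u⟩
      map_add' := fun u v => NNReal.eq (posPartFun_add hL u v)
      map_smul' := fun c u => NNReal.eq (posPartFun_smul c u) }
  -- The negative part is defined as positive part minus L; it is nonnegative because u itself
  -- competes in the supremum.
  let N : C_c(X, ℝ≥0) →ₗ[ℝ≥0] ℝ≥0 :=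
    { toFun := fun u => ⟨posPartFun L u - L u.toReal, sub_nonneg.2 (le_posPartFun hL u)⟩
      map_add' := fun u v => NNReal.eq (by
        change posPartFun L (u + v) - L (u + v).toReal =
          (posPartFun L u - L u.toReal) + (posPartFun L v - L v.toReal)
        rw [posPartFun_add hL, CompactlySupportedContinuousMap.toReal_add, map_add]
        ring)
      map_smul' := fun c u => NNReal.eq (by
        change posPartFun L (c • u) - L (c • u).toReal = c * (posPartFun L u - L u.toReal)
        rw [posPartFun_smul, map_toReal_smul]
        ring) }
  have hPN : ∀ u, (P u : ℝ) - N u = L u.toReal := fun u => by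
    change posPartFun L u - (posPartFun L u - L u.toReal) = _
    ring
  refine ⟨RealRMK.rieszMeasure (CompactlySupportedContinuousMap.toRealPositiveLinear P),
    RealRMK.rieszMeasure (CompactlySupportedContinuousMap.toRealPositiveLinear N),
    inferInstance, inferInstance, fun u => ?_⟩
  rw [RealRMK.integral_rieszMeasure, RealRMK.integral_rieszMeasure,
    CompactlySupportedContinuousMap.toRealPositiveLinear_apply,
    CompactlySupportedContinuousMap.toRealPositiveLinear_apply]
  conv_lhs => rw [← CompactlySupportedContinuousMap.nnrealPart_sub_nnrealPart_neg u, map_sub,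
    ← hPN, ← hPN]
  ring

end Riesz

/-! ### Functionals on smooth functions with compact support -/

/-- A smooth function with compact support. -/
structure IsTest {V F : Type*} [NormedAddCommGroup V] [NormedSpace ℝ V] [NormedAddCommGroup F]
    [NormedSpace ℝ F] (φ : V → F) : Prop where
  contDiff : ContDiff ℝ (⊤ : ℕ∞) φ
  hasCompactSupport : HasCompactSupport φ

section Extension

variable {V : Type*} [NormedAddCommGroup V] [NormedSpace ℝ V]

theorem IsTest.add {φ ψ : V → ℝ} (hφ : IsTest φ) (hψ : IsTest ψ) : IsTest (φ + ψ) :=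
  ⟨hφ.1.add hψ.1, hφ.2.add hψ.2⟩

theorem IsTest.smul {φ : V → ℝ} (c : ℝ) (hφ : IsTest φ) : IsTest (c • φ) :=
  ⟨hφ.1.const_smul c, hφ.2.smul_left (f := fun _ => c)⟩

/-- A linear functional on the smooth functions with compact support which is bounded, with respect
to the uniform norm, on the functions supported in a given compact set. -/
structure IsLocallyBoundedFunctional (l : (V → ℝ) → ℝ) : Prop where
  map_add : ∀ φ ψ, IsTest φ → IsTest ψ → l (φ + ψ) = l φ + l ψ
  map_smul : ∀ (c : ℝ) φ, IsTest φ → l (c • φ) = c * l φ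
  exists_bound : ∀ K, IsCompact K → ∃ C : ℝ, 0 ≤ C ∧ ∀ φ, IsTest φ → tsupport φ ⊆ K →
    ∀ M, (∀ x, |φ x| ≤ M) → |l φ| ≤ C * M

theorem IsLocallyBoundedFunctional.abs_sub_le {l : (V → ℝ) → ℝ} {K : Set V} {C : ℝ}
    (hl : IsLocallyBoundedFunctional l)
    (hC : ∀ φ, IsTest φ → tsupport φ ⊆ K → ∀ M, (∀ x, |φ x| ≤ M) → |l φ| ≤ C * M)
    {φ ψ : V → ℝ} (hφ : IsTest φ) (hψ : IsTest ψ) (hφK : tsupport φ ⊆ K) (hψK : tsupport ψ ⊆ K)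
    {M : ℝ} (hM : ∀ x, |φ x - ψ x| ≤ M) : |l φ - l ψ| ≤ C * M := by
  have h1 : l (φ + (-1 : ℝ) • ψ) = l φ - l ψ := by
    rw [hl.map_add _ _ hφ (hψ.smul _), hl.map_smul _ _ hψ]; ring
  rw [← h1]
  refine hC _ (hφ.add (hψ.smul _)) ?_ M fun x => by simpa [sub_eq_add_neg] using hM x
  refine (tsupport_add φ _).trans (Set.union_subset hφK ?_)
  exact (closure_mono (Function.support_const_smul_subset _ _)).trans hψK

theorem le_of_forall_pos_le_add_mul {a b c : ℝ} (h : ∀ ε : ℝ, 0 < ε → a ≤ b + c * ε) : a ≤ b := by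
  have h1 : Tendsto (fun ε : ℝ => b + c * ε) (𝓝[>] 0) (𝓝 (b + c * 0)) :=
    (Continuous.tendsto (by fun_prop) 0).mono_left nhdsWithin_le_nhds
  rw [mul_zero, add_zero] at h1
  exact ge_of_tendsto h1 (eventually_nhdsWithin_of_forall fun ε hε => h ε hε)

variable [FiniteDimensional ℝ V]

/-- The approximant must not enlarge the support, since the bounds on functionals depend on a
compact set containing it. -/
theorem exists_isTest_approx (u : C_c(V, ℝ)) {ε : ℝ} (hε : 0 < ε) :
    ∃ φ : V → ℝ, IsTest φ ∧ tsupport φ ⊆ tsupport u ∧ ∀ x, |φ x - u x| ≤ ε := by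
  obtain ⟨g, hg, hd, hs⟩ := u.continuous.exists_contDiff_approx (⊤ : ℕ∞)
    (ε := fun _ => ε) continuous_const fun _ => hε
  exact ⟨g, ⟨hg, u.hasCompactSupport.mono hs⟩, closure_mono hs, fun x => (hd x).le⟩

/-- A locally bounded functional extends to the continuous functions with compact support. -/
theorem IsLocallyBoundedFunctional.exists_extension {l : (V → ℝ) → ℝ}
    (hl : IsLocallyBoundedFunctional l) : ∃ L : C_c(V, ℝ) →ₗ[ℝ] ℝ,
      (∀ u : C_c(V, ℝ), IsTest u → L u = l u) ∧ ∀ K, IsCompact K → ∃ C : ℝ,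
        ∀ u : C_c(V, ℝ), tsupport u ⊆ K → ∀ M, (∀ x, |u x| ≤ M) → |L u| ≤ C * M := by
  choose! C hC0 hC using hl.exists_bound
  -- The value r is characterized by an estimate valid for every test function near u, not only for
  -- one approximating sequence. Linearity, agreement with `l` and the local bound all follow from
  -- this estimate.
  have key : ∀ u : C_c(V, ℝ), ∃ r : ℝ, ∀ K, IsCompact K → tsupport u ⊆ K → ∀ φ, IsTest φ →
      tsupport φ ⊆ K → ∀ δ, (∀ x, |φ x - u x| ≤ δ) → |l φ - r| ≤ C K * δ := by
    intro u
    have hpos : ∀ k : ℕ, (0 : ℝ) < 1 / (k + 1) := fun k => Nat.one_div_pos_of_nat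
    choose φ hφ hsupp happ using fun k : ℕ => exists_isTest_approx u (hpos k)
    have hK := u.hasCompactSupport.isCompact
    have hlim : Tendsto (fun k : ℕ => (1 : ℝ) / (k + 1)) atTop (𝓝 0) :=
      tendsto_one_div_add_atTop_nhds_zero_nat
    have hc : CauchySeq fun k => l (φ k) := by
      refine cauchySeq_of_le_tendsto_0 (fun N : ℕ => C (tsupport u) * (2 * (1 / ((N : ℝ) + 1))))
        (fun k m N hk hm => ?_) (by simpa using (hlim.const_mul 2).const_mul (C (tsupport u)))
      refine hl.abs_sub_le (hC _ hK) (hφ k) (hφ m) (hsupp k) (hsupp m) fun x => ?_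
      have h1 := Nat.one_div_le_one_div (α := ℝ) hk
      have h2 := Nat.one_div_le_one_div (α := ℝ) hm
      calc |φ k x - φ m x| = |(φ k x - u x) - (φ m x - u x)| := by ring_nf
        _ ≤ |φ k x - u x| + |φ m x - u x| := abs_sub _ _
        _ ≤ _ := by linarith [happ k x, happ m x]
    obtain ⟨r, hr⟩ := cauchySeq_tendsto_of_complete hc
    refine ⟨r, fun K hKc huK ψ hψ hψK δ hδ => ?_⟩
    have h1 : Tendsto (fun k => |l ψ - l (φ k)|) atTop (𝓝 |l ψ - r|) :=
      (hr.const_sub (l ψ)).abs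
    have h2 : Tendsto (fun k : ℕ => C K * (δ + 1 / ((k : ℝ) + 1))) atTop (𝓝 (C K * (δ + 0))) :=
      (hlim.const_add δ).const_mul _
    rw [add_zero] at h2
    refine le_of_tendsto_of_tendsto' h1 h2 fun k => ?_
    refine hl.abs_sub_le (hC K hKc) hψ (hφ k) hψK ((hsupp k).trans huK) fun x => ?_
    calc |ψ x - φ k x| = |(ψ x - u x) - (φ k x - u x)| := by ring_nf
      _ ≤ |ψ x - u x| + |φ k x - u x| := abs_sub _ _
      _ ≤ _ := add_le_add (hδ x) (happ k x)
  choose L hLl using key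
  refine ⟨{ toFun := L, map_add' := fun u w => ?_, map_smul' := fun c u => ?_ }, fun u hu => ?_,
    fun K hK => ⟨C K, fun u huK M hM => ?_⟩⟩
  · have hu := u.hasCompactSupport.isCompact
    have hw := w.hasCompactSupport.isCompact
    set K := tsupport u ∪ tsupport w
    have hsub : tsupport (u + w) ⊆ K := tsupport_add _ _
    refine eq_of_abs_sub_le_all fun η hη => ?_
    refine le_of_forall_pos_le_add_mul (c := 4 * C K) fun ε hε => ?_
    obtain ⟨φ, hφ, hφs, hφa⟩ := exists_isTest_approx u hε
    obtain ⟨ψ, hψ, hψs, hψa⟩ := exists_isTest_approx w hε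
    have h1 := hLl u K (hu.union hw) Set.subset_union_left φ hφ
      (hφs.trans Set.subset_union_left) ε hφa
    have h2 := hLl w K (hu.union hw) Set.subset_union_right ψ hψ
      (hψs.trans Set.subset_union_right) ε hψa
    have h3 := hLl (u + w) K (hu.union hw) hsub (φ + ψ) (hφ.add hψ)
      ((tsupport_add φ ψ).trans (Set.union_subset_union hφs hψs)) (2 * ε) fun x => by
        calc |(φ + ψ) x - (u + w) x| = |(φ x - u x) + (ψ x - w x)| := by
              simp only [Pi.add_apply, CompactlySupportedContinuousMap.coe_add]; ring_nf
          _ ≤ |φ x - u x| + |ψ x - w x| := abs_add_le _ _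
          _ ≤ 2 * ε := by linarith [hφa x, hψa x]
    rw [hl.map_add _ _ hφ hψ] at h3
    rw [abs_le] at h1 h2 h3 ⊢
    constructor <;> linarith [h1.1, h1.2, h2.1, h2.2, h3.1, h3.2]
  · have hu := u.hasCompactSupport.isCompact
    have hsub : tsupport (c • u) ⊆ tsupport u :=
      closure_mono (Function.support_const_smul_subset c u)
    refine eq_of_abs_sub_le_all fun η hη => ?_
    refine le_of_forall_pos_le_add_mul (c := 2 * (|c| * C (tsupport u))) fun ε hε => ?_
    obtain ⟨φ, hφ, hφs, hφa⟩ := exists_isTest_approx u hε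
    have h1 := hLl u _ hu subset_rfl φ hφ hφs ε hφa
    have h3 := hLl (c • u) _ hu hsub (c • φ) (hφ.smul c)
      ((closure_mono (Function.support_const_smul_subset c φ)).trans hφs) (|c| * ε) fun x => by
        calc |(c • φ) x - (c • u) x| = |c| * |φ x - u x| := by
              rw [← abs_mul]
              simp only [Pi.smul_apply, CompactlySupportedContinuousMap.coe_smul, smul_eq_mul]
              ring_nf
          _ ≤ |c| * ε := by gcongr; exact hφa x
    rw [hl.map_smul _ _ hφ] at h3
    simp only [RingHom.id_apply, smul_eq_mul]
    calc |L (c • u) - c * L u| = |c * (l φ - L u) - (c * l φ - L (c • u))| := by ring_nf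
      _ ≤ |c * (l φ - L u)| + |c * l φ - L (c • u)| := abs_sub _ _
      _ ≤ |c| * (C (tsupport u) * ε) + C (tsupport u) * (|c| * ε) := by
          rw [abs_mul]; gcongr
      _ ≤ η + 2 * (|c| * C (tsupport u)) * ε := by linarith
  -- A test function approximates itself with error δ = 0.
  · have h1 := hLl u _ u.hasCompactSupport.isCompact subset_rfl u hu subset_rfl 0 (by simp)
    rw [mul_zero] at h1
    exact (sub_eq_zero.1 (abs_nonpos_iff.1 h1)).symm
  · refine le_of_forall_pos_le_add_mul (c := 2 * C K) fun ε hε => ?_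
    obtain ⟨φ, hφ, hφs, hφa⟩ := exists_isTest_approx u hε
    have h1 := hLl u K hK huK φ hφ (hφs.trans huK) ε hφa
    have h2 := hC K hK φ hφ (hφs.trans huK) (M + ε) fun x => by
      have h3 := hφa x
      have h4 := hM x
      rw [abs_le] at h3 h4 ⊢
      constructor <;> linarith [h3.1, h3.2, h4.1, h4.2]
    change |L u| ≤ _
    rw [abs_le] at h1 h2 ⊢
    constructor <;> linarith [h1.1, h1.2, h2.1, h2.2]

theorem IsLocallyBoundedFunctional.exists_measure [MeasurableSpace V] [BorelSpace V]
    {l : (V → ℝ) → ℝ} (hl : IsLocallyBoundedFunctional l) :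
    ∃ μ ν : Measure V, IsFiniteMeasureOnCompacts μ ∧ IsFiniteMeasureOnCompacts ν ∧
      ∀ φ, IsTest φ → l φ = ∫ x, φ x ∂μ - ∫ x, φ x ∂ν := by
  obtain ⟨L, hL, hb⟩ := hl.exists_extension
  have := FiniteDimensional.proper ℝ V
  obtain ⟨μ, ν, hμ, hν, h⟩ := exists_measure_sub_measure L (bddAbove_valuesBelow hb)
  refine ⟨μ, ν, hμ, hν, fun φ hφ => ?_⟩
  let u : C_c(V, ℝ) := ⟨⟨φ, hφ.1.continuous⟩, hφ.2⟩
  have h1 : L u = l φ := hL u hφ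
  rw [← h1, h u]
  rfl

end Extension

/-! ### Polar decomposition -/

theorem norm_le_sum_abs {n : ℕ} (x : E n) : ‖x‖ ≤ ∑ i, |x i| := by
  rw [EuclideanSpace.norm_eq]
  refine Real.sqrt_le_iff.2 ⟨Finset.sum_nonneg fun _ _ => abs_nonneg _, ?_⟩
  simp only [Real.norm_eq_abs]
  exact Finset.sum_sq_le_sq_sum_of_nonneg fun _ _ => abs_nonneg _

/-- The vector measure with components `μ_i - ν_i`. -/
theorem exists_radonVectorMeasure {n : ℕ} (μ ν : Fin n → Measure (E n))
    [∀ i, IsFiniteMeasureOnCompacts (μ i)] [∀ i, IsFiniteMeasureOnCompacts (ν i)] :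
    ∃ ρ : RadonVectorMeasure n, ∀ φ : E n → E n, Continuous φ → HasCompactSupport φ →
      ρ.integral φ = ∑ i, (∫ x, φ x i ∂μ i - ∫ x, φ x i ∂ν i) := by
  set m : Measure (E n) := ∑ i, (μ i + ν i) with hm
  have hmK : IsFiniteMeasureOnCompacts m := ⟨fun K hK => by
    rw [hm, Measure.coe_finsetSum, Finset.sum_apply]
    exact ENNReal.sum_lt_top.2 fun i _ => by
      rw [Measure.add_apply]
      exact ENNReal.add_lt_top.2 ⟨hK.measure_lt_top, hK.measure_lt_top⟩⟩
  have hle : ∀ i, μ i + ν i ≤ m := fun i =>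
    Finset.single_le_sum (f := fun i => μ i + ν i) (fun _ _ => Measure.zero_le _)
      (Finset.mem_univ i)
  have hμ : ∀ i, μ i ≪ m := fun i =>
    Measure.absolutelyContinuous_of_le ((Measure.le_add_right le_rfl).trans (hle i))
  have hν : ∀ i, ν i ≪ m := fun i =>
    Measure.absolutelyContinuous_of_le ((Measure.le_add_left le_rfl).trans (hle i))
  -- The density of the vector measure with respect to m, which dominates every component.
  set g : E n → E n := fun x => WithLp.toLp 2 fun i =>
    ((μ i).rnDeriv m x).toReal - ((ν i).rnDeriv m x).toReal with hg
  have hgm : Measurable g := by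
    refine (WithLp.measurable_toLp 2 _).comp (measurable_pi_lambda _ fun i => ?_)
    exact (Measure.measurable_rnDeriv _ _).ennreal_toReal.sub
      (Measure.measurable_rnDeriv _ _).ennreal_toReal
  have hgn : ∀ᵐ x ∂m, ‖g x‖ₑ ≤ ∑ i, ((μ i).rnDeriv m x + (ν i).rnDeriv m x) := by
    have h1 : ∀ᵐ x ∂m, ∀ i, (μ i).rnDeriv m x < ∞ ∧ (ν i).rnDeriv m x < ∞ := by
      rw [ae_all_iff]
      exact fun i => (Measure.rnDeriv_lt_top _ _).and (Measure.rnDeriv_lt_top _ _)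
    filter_upwards [h1] with x hx
    rw [← ofReal_norm]
    calc ENNReal.ofReal ‖g x‖
        ≤ ENNReal.ofReal (∑ i, (((μ i).rnDeriv m x).toReal + ((ν i).rnDeriv m x).toReal)) := by
          refine ENNReal.ofReal_le_ofReal ((norm_le_sum_abs _).trans
            (Finset.sum_le_sum fun i _ => ?_))
          refine (abs_sub _ _).trans_eq ?_
          rw [abs_of_nonneg ENNReal.toReal_nonneg, abs_of_nonneg ENNReal.toReal_nonneg]
      _ = _ := by
          rw [ENNReal.ofReal_sum_of_nonneg fun i _ => by positivity]
          refine Finset.sum_congr rfl fun i _ => ?_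
          rw [ENNReal.ofReal_add ENNReal.toReal_nonneg ENNReal.toReal_nonneg,
            ENNReal.ofReal_toReal (hx i).1.ne, ENNReal.ofReal_toReal (hx i).2.ne]
  -- Polar form: total variation |g| m and direction g/|g|. The set where g = 0 carries no mass, so
  -- the default value of the direction there is harmless.
  refine ⟨⟨m.withDensity fun x => ‖g x‖ₑ, fun x => ‖g x‖⁻¹ • g x, ⟨fun K hK => ?_⟩,
    hgm.norm.inv.smul hgm, ?_⟩, fun φ hφ hs => ?_⟩
  · rw [withDensity_apply' _ K]
    calc ∫⁻ x in K, ‖g x‖ₑ ∂m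
        ≤ ∫⁻ x in K, ∑ i, ((μ i).rnDeriv m x + (ν i).rnDeriv m x) ∂m :=
          lintegral_mono_ae (ae_restrict_of_ae hgn)
      _ = ∑ i, (∫⁻ x in K, (μ i).rnDeriv m x ∂m + ∫⁻ x in K, (ν i).rnDeriv m x ∂m) := by
          rw [lintegral_finsetSum _ fun i _ => by fun_prop]
          exact Finset.sum_congr rfl fun i _ =>
            lintegral_add_left (Measure.measurable_rnDeriv _ _) _
      _ ≤ ∑ i, (μ i K + ν i K) := Finset.sum_le_sum fun i _ =>
          add_le_add (Measure.setLIntegral_rnDeriv_le K) (Measure.setLIntegral_rnDeriv_le K)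
      _ < ∞ := ENNReal.sum_lt_top.2 fun i _ =>
          ENNReal.add_lt_top.2 ⟨hK.measure_lt_top, hK.measure_lt_top⟩
  · rw [ae_withDensity_iff hgm.enorm]
    refine .of_forall fun x hx => ?_
    rw [norm_smul, norm_inv, norm_norm, inv_mul_cancel₀]
    simpa using hx
  · have hφi : ∀ i, Continuous fun x => φ x i := fun i => by fun_prop
    have hφs : ∀ i, HasCompactSupport fun x => φ x i := fun i =>
      hs.comp_left (g := fun y : E n => y i) rfl
    have h1 : ∀ i, Integrable (fun x => ((μ i).rnDeriv m x).toReal * φ x i) m := fun i =>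
      (integrable_toReal_rnDeriv_mul_iff (hμ i)).2
        ((hφi i).integrable_of_hasCompactSupport (hφs i))
    have h2 : ∀ i, Integrable (fun x => ((ν i).rnDeriv m x).toReal * φ x i) m := fun i =>
      (integrable_toReal_rnDeriv_mul_iff (hν i)).2
        ((hφi i).integrable_of_hasCompactSupport (hφs i))
    rw [RadonVectorMeasure.integral, integral_withDensity_eq_integral_toReal_smul hgm.enorm
      (.of_forall fun x => enorm_lt_top)]
    have h3 : ∀ x, ‖g x‖ₑ.toReal • inner ℝ (φ x) (‖g x‖⁻¹ • g x) =
        ∑ i, (((μ i).rnDeriv m x).toReal * φ x i - ((ν i).rnDeriv m x).toReal * φ x i) := by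
      intro x
      have h4 : ‖g x‖ₑ.toReal • inner ℝ (φ x) (‖g x‖⁻¹ • g x) = inner ℝ (φ x) (g x) := by
        rw [inner_smul_right, toReal_enorm, smul_eq_mul]
        rcases eq_or_ne (g x) 0 with h0 | h0
        · simp [h0]
        · rw [mul_inv_cancel_left₀ (norm_ne_zero_iff.2 h0)]
      rw [h4, PiLp.inner_apply]
      refine Finset.sum_congr rfl fun i _ => ?_
      rw [← sub_mul]
      rfl
    simp only [h3]
    rw [integral_finsetSum _ fun i _ => by exact (h1 i).sub (h2 i)]
    refine Finset.sum_congr rfl fun i _ => ?_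
    rw [integral_sub (h1 i) (h2 i), integral_toReal_rnDeriv_mul (hμ i),
      integral_toReal_rnDeriv_mul (hν i)]

end FracBV

namespace FracBV

open Metric Filter Topology Module

variable {n : ℕ} {α : ℝ}

/-! ### The fractional divergence -/

/-- The kernel of the `i`-th fractional partial derivative. -/
noncomputable abbrev coordKernel (α : ℝ) (i : Fin n) : E n → ℝ :=
  rieszKernel α (EuclideanSpace.single i (1 : ℝ))

theorem mu_pos (n : ℕ) (hα0 : 0 < α) (hα1 : α < 1) : 0 < mu n α := by
  unfold mu
  have h1 : 0 < Real.Gamma (((n : ℝ) + α + 1) / 2) := Real.Gamma_pos_of_pos (by positivity)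
  have h2 : 0 < Real.Gamma ((1 - α) / 2) := Real.Gamma_pos_of_pos (by linarith)
  have := Real.pi_pos
  positivity

theorem coordKernel_apply (i : Fin n) (h : E n) :
    coordKernel α i h = h i / ‖h‖ ^ ((n : ℝ) + α + 1) := by
  rw [coordKernel, rieszKernel, EuclideanSpace.inner_single_left, finrank_euclideanSpace_fin]
  simp

theorem fracDiv_eq_integral_add (φ : E n → E n) (x : E n) :
    fracDiv α φ x = mu n α * ∫ h : E n, ∑ i, coordKernel α i h • diff h (fun y => φ y i) x := by
  rw [fracDiv, ← integral_add_left_eq_self _ x]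
  congr 2 with h
  rw [add_sub_cancel_left, PiLp.inner_apply, Finset.sum_div]
  refine Finset.sum_congr rfl fun i _ => ?_
  rw [coordKernel_apply, smul_eq_mul, div_mul_eq_mul_div]
  rfl

theorem fracDiv_smul_single (i : Fin n) (u : E n → ℝ) (x : E n) :
    fracDiv α (fun y => u y • EuclideanSpace.single i (1 : ℝ)) x =
      mu n α * diffOp (coordKernel α i) u x := by
  rw [fracDiv_eq_integral_add, diffOp]
  congr 2 with h
  rw [Finset.sum_eq_single i]
  · simp [diff]
  · intro j _ hj
    simp [diff, hj]
  · simp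

theorem IsTest.isL1Lipschitz {u : E n → ℝ} (hu : IsTest u) : IsL1Lipschitz u :=
  isL1Lipschitz_of_contDiff (mod_cast contDiff_infty.1 hu.1 2) hu.2

theorem IsTest.component {φ : E n → E n} (hφ : IsTest φ) (i : Fin n) :
    IsTest fun x => φ x i :=
  ⟨(EuclideanSpace.proj (𝕜 := ℝ) i : E n →L[ℝ] ℝ).contDiff.comp hφ.1,
    hφ.2.comp_left (g := fun y : E n => y i) rfl⟩

theorem IsTest.smul_single {u : E n → ℝ} (hu : IsTest u) (i : Fin n) :
    IsTest fun x => u x • (EuclideanSpace.single i (1 : ℝ) : E n) :=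
  ⟨hu.1.smul contDiff_const, hu.2.smul_right⟩

theorem isTest_coe (φ : 𝓓((⊤ : Opens (E n)), E n)) : IsTest φ :=
  ⟨φ.contDiff, φ.hasCompactSupport⟩

theorem isLevyKernel_coordKernel (hα0 : 0 < α) (hα1 : α < 1) (i : Fin n) :
    IsLevyKernel (coordKernel α i) := by
  have : NeZero n := ⟨by rintro rfl; exact i.elim0⟩
  have : Nontrivial (E n) := inferInstance
  exact isLevyKernel_rieszKernel hα0 hα1 _

/-- The sum leaves the integral wherever all the component integrals converge, which is guaranteed
almost everywhere. -/
theorem fracDiv_ae_eq (hα0 : 0 < α) (hα1 : α < 1) {φ : E n → E n} (hφ : IsTest φ) :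
    ∀ᵐ x, fracDiv α φ x = mu n α * ∑ i, diffOp (coordKernel α i) (fun y => φ y i) x := by
  have h1 : ∀ᵐ x, ∀ i, Integrable fun h => coordKernel α i h • diff h (fun y => φ y i) x :=
    ae_all_iff.2 fun i =>
      ae_integrable_diff (isLevyKernel_coordKernel hα0 hα1 i) (hφ.component i).isL1Lipschitz
  filter_upwards [h1] with x hx
  rw [fracDiv_eq_integral_add, integral_finsetSum _ fun i _ => hx i]
  rfl

variable {f : E n → ℝ}

theorem integrable_mul_diffOp (hα0 : 0 < α) (hα1 : α < 1) (hf : MemLp f ∞ volume) (i : Fin n)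
    {u : E n → ℝ} (hu : IsTest u) : Integrable fun x => f x * diffOp (coordKernel α i) u x :=
  (integrable_diffOp (isLevyKernel_coordKernel hα0 hα1 i) hu.isL1Lipschitz).mul_of_top_right hf

theorem integral_mul_fracDiv (hα0 : 0 < α) (hα1 : α < 1) (hf : MemLp f ∞ volume)
    {φ : E n → E n} (hφ : IsTest φ) : ∫ x, f x * fracDiv α φ x =
      ∑ i, mu n α * ∫ x, f x * diffOp (coordKernel α i) (fun y => φ y i) x := by
  calc ∫ x, f x * fracDiv α φ x
      = ∫ x, ∑ i, mu n α * (f x * diffOp (coordKernel α i) (fun y => φ y i) x) := by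
        refine integral_congr_ae ?_
        filter_upwards [fracDiv_ae_eq hα0 hα1 hφ] with x hx
        rw [hx, ← Finset.mul_sum, ← Finset.mul_sum]
        ring
    _ = _ := by
        rw [integral_finsetSum _ fun i _ => by
          exact (integrable_mul_diffOp hα0 hα1 hf i (hφ.component i)).const_mul _]
        simp only [integral_const_mul]

/-! ### Existence of the fractional variation -/

/-- The `i`-th component of the fractional variation, as a functional. -/
noncomputable def fracFunctional (α : ℝ) (f : E n → ℝ) (i : Fin n) (u : E n → ℝ) : ℝ :=
  -(mu n α * ∫ x, f x * diffOp (coordKernel α i) u x)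

theorem fracFunctional_eq (i : Fin n) (u : E n → ℝ) : fracFunctional α f i u =
    -∫ x, f x * fracDiv α (fun y => u y • EuclideanSpace.single i (1 : ℝ)) x := by
  rw [fracFunctional, ← integral_const_mul]
  congr 2 with x
  rw [fracDiv_smul_single]
  ring

/-- Scalars pass through Bochner integrals whether or not these converge, so u may be arbitrary. -/
theorem fracFunctional_smul (i : Fin n) (c : ℝ) (u : E n → ℝ) :
    fracFunctional α f i (c • u) = c * fracFunctional α f i u := by
  have : ∀ x, diffOp (coordKernel α i) (c • u) x = c * diffOp (coordKernel α i) u x := by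
    intro x
    rw [diffOp, diffOp, ← integral_const_mul]
    congr 1 with h
    simp only [diff, Pi.smul_apply, smul_eq_mul]
    ring
  simp only [fracFunctional, this, mul_left_comm (f _) c, integral_const_mul]
  ring

theorem exists_bound_fracFunctional (hf : MemBVLoc α ∞ f) (i : Fin n) {K : Set (E n)}
    (hK : IsCompact K) : ∃ C : ℝ, 0 ≤ C ∧ ∀ u, IsTest u → tsupport u ⊆ K →
      ∀ M, (∀ x, |u x| ≤ M) → |fracFunctional α f i u| ≤ C * M := by
  obtain ⟨R, hR⟩ := hK.isBounded.subset_ball 0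
  obtain ⟨B, hB⟩ := hf.2 ⟨ball 0 R, isOpen_ball⟩
    ((isCompact_closedBall 0 R).of_isClosed_subset isClosed_closure closure_ball_subset_closedBall)
  have hle : ∀ u, IsTest u → tsupport u ⊆ K → (∀ x, |u x| ≤ 1) → -fracFunctional α f i u ≤ B := by
    intro u hu huK hu1
    have ht := hu.smul_single i
    refine hB ⟨⟨_, ht.1, ht.2, ?_⟩, fun x => ?_, ?_⟩
    · exact (closure_mono (Function.support_smul_subset_left _ _)).trans (huK.trans hR)
    · change ‖u x • (EuclideanSpace.single i (1 : ℝ) : E n)‖ ≤ 1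
      rw [norm_smul, PiLp.norm_single, norm_one, mul_one]
      exact hu1 x
    · rw [fracFunctional_eq, neg_neg]
      rfl
  -- The variation condition bounds from one side only; the other side comes from -u.
  have habs : ∀ u, IsTest u → tsupport u ⊆ K → (∀ x, |u x| ≤ 1) →
      |fracFunctional α f i u| ≤ B := by
    intro u hu huK hu1
    have h1 := hle u hu huK hu1
    have h2 := hle ((-1 : ℝ) • u) (hu.smul _)
      ((closure_mono (Function.support_const_smul_subset _ _)).trans huK) (by simpa using hu1)
    rw [fracFunctional_smul] at h2
    rw [abs_le]
    constructor <;> linarith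
  refine ⟨max B 0, le_max_right _ _, fun u hu huK M hM => ?_⟩
  -- For M = 0 the function is zero; otherwise the unit bound is applied to u/M.
  rcases ((abs_nonneg _).trans (hM 0)).eq_or_lt with rfl | hM0
  · have h1 : u = (0 : ℝ) • u := by
      ext x
      simpa using hM x
    rw [h1, fracFunctional_smul]
    simp
  · have h1 := habs (M⁻¹ • u) (hu.smul _)
      ((closure_mono (Function.support_const_smul_subset _ _)).trans huK) fun x => by
        rw [Pi.smul_apply, smul_eq_mul, abs_mul, abs_of_pos (inv_pos.2 hM0),
          inv_mul_le_iff₀ hM0, mul_one]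
        exact hM x
    rw [fracFunctional_smul, abs_mul, abs_of_pos (inv_pos.2 hM0), inv_mul_le_iff₀ hM0,
      mul_comm] at h1
    exact h1.trans (mul_le_mul_of_nonneg_right (le_max_left _ _) hM0.le)

theorem isLocallyBoundedFunctional_fracFunctional (hα0 : 0 < α) (hα1 : α < 1)
    (hf : MemBVLoc α ∞ f) (i : Fin n) : IsLocallyBoundedFunctional (fracFunctional α f i) where
  map_add u w hu hw := by
    have hk := isLevyKernel_coordKernel hα0 hα1 i
    have h1 : ∀ᵐ x, f x * diffOp (coordKernel α i) (u + w) x =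
        f x * diffOp (coordKernel α i) u x + f x * diffOp (coordKernel α i) w x := by
      filter_upwards [ae_integrable_diff hk hu.isL1Lipschitz,
        ae_integrable_diff hk hw.isL1Lipschitz] with x hx hx'
      rw [← mul_add, diffOp, diffOp, diffOp, ← integral_add hx hx']
      congr 2 with h
      simp only [diff, Pi.add_apply, smul_eq_mul]
      ring
    rw [fracFunctional, integral_congr_ae h1, integral_add (integrable_mul_diffOp hα0 hα1 hf.1 i hu)
      (integrable_mul_diffOp hα0 hα1 hf.1 i hw), fracFunctional, fracFunctional]
    ring
  map_smul c u _ := fracFunctional_smul i c u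
  exists_bound _ hK := exists_bound_fracFunctional hf i hK

theorem exists_isFracVariation (hα0 : 0 < α) (hα1 : α < 1) (hf : MemBVLoc α ∞ f) :
    ∃ ρ : RadonVectorMeasure n, IsFracVariation α f ρ := by
  choose μ ν hμ hν h using fun i =>
    (isLocallyBoundedFunctional_fracFunctional hα0 hα1 hf i).exists_measure
  obtain ⟨ρ, hρ⟩ := exists_radonVectorMeasure μ ν
  refine ⟨ρ, fun φ => ?_⟩
  have hφ := isTest_coe φ
  rw [hρ φ φ.continuous φ.hasCompactSupport, integral_mul_fracDiv hα0 hα1 hf.1 hφ,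
    ← Finset.sum_neg_distrib]
  refine Finset.sum_congr rfl fun i _ => ?_
  rw [← h i _ (hφ.component i), fracFunctional, neg_neg]

/-! ### Vanishing of a component -/

theorem RadonVectorMeasure.locallyIntegrable_density (ρ : RadonVectorMeasure n) (i : Fin n) :
    LocallyIntegrable (fun x => ρ.density x i) ρ.totalVar := by
  have := ρ.finite_on_compacts
  have hm : Measurable fun x => ρ.density x i :=
    (EuclideanSpace.proj (𝕜 := ℝ) i : E n →L[ℝ] ℝ).measurable.comp ρ.measurable_density
  refine (locallyIntegrable_const (1 : ℝ)).mono hm.aestronglyMeasurable ?_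
  filter_upwards [ρ.norm_density] with x hx
  rw [norm_one, ← hx]
  exact PiLp.norm_apply_le _ i

theorem RadonVectorMeasure.component_apply (ρ : RadonVectorMeasure n) (i : Fin n)
    {A : Set (E n)} (hA : MeasurableSet A) (hb : Bornology.IsBounded A) :
    ρ.component i A = ∫ x in A, ρ.density x i ∂ρ.totalVar := by
  have := ρ.finite_on_compacts
  rw [component, val, if_pos ⟨hA, hb⟩]
  have hint : IntegrableOn ρ.density A ρ.totalVar := by
    have h1 : LocallyIntegrable ρ.density ρ.totalVar := by
      refine (locallyIntegrable_const (1 : ℝ)).mono ρ.measurable_density.aestronglyMeasurable ?_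
      filter_upwards [ρ.norm_density] with x hx
      rw [hx, norm_one]
    exact (h1.integrableOn_isCompact hb.isCompact_closure).mono_set subset_closure
  exact ((EuclideanSpace.proj (𝕜 := ℝ) i : E n →L[ℝ] ℝ).integral_comp_comm hint).symm

/-- Both conditions say that the i-th coordinate of the density vanishes a.e. for the total
variation. -/
theorem RadonVectorMeasure.component_eq_zero_iff (ρ : RadonVectorMeasure n) (i : Fin n) :
    ρ.component i = 0 ↔
      ∀ u : E n → ℝ, IsTest u → ∫ x, u x * ρ.density x i ∂ρ.totalVar = 0 := by
  have := ρ.finite_on_compacts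
  have hloc := ρ.locallyIntegrable_density i
  constructor
  · intro h u _
    -- The set function carries information on bounded sets only, so the density is examined on
    -- balls, which exhaust the space.
    have hz : ∀ N : ℕ, ∀ᵐ x ∂ρ.totalVar, x ∈ ball (0 : E n) N → ρ.density x i = 0 := by
      intro N
      rw [← ae_restrict_iff' measurableSet_ball]
      have hint : IntegrableOn (fun x => ρ.density x i) (ball (0 : E n) N) ρ.totalVar :=
        (hloc.integrableOn_isCompact (isCompact_closedBall 0 (N : ℝ))).mono_set
          ball_subset_closedBall
      refine hint.ae_eq_zero_of_forall_setIntegral_eq_zero fun s hs _ => ?_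
      rw [Measure.restrict_restrict hs, ← ρ.component_apply i (hs.inter measurableSet_ball)
        (isBounded_ball.subset Set.inter_subset_right), h]
      rfl
    refine integral_eq_zero_of_ae ?_
    filter_upwards [ae_all_iff.2 hz] with x hx
    obtain ⟨N, hN⟩ := exists_nat_gt ‖x‖
    rw [hx N (by simpa using hN), mul_zero]
    rfl
  · intro h
    have hae := ae_eq_zero_of_integral_contDiff_smul_eq_zero hloc fun u hu hs => h u ⟨hu, hs⟩
    ext A
    by_cases hA : MeasurableSet A ∧ Bornology.IsBounded A
    · rw [ρ.component_apply i hA.1 hA.2]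
      exact integral_eq_zero_of_ae (ae_restrict_of_ae hae)
    · rw [component, val, if_neg hA]
      rfl

/-- Testing with u e_i isolates the i-th component. -/
theorem IsFracVariation.integral_density {ρ : RadonVectorMeasure n}
    (hρ : IsFracVariation α f ρ) (i : Fin n) {u : E n → ℝ} (hu : IsTest u) :
    ∫ x, u x * ρ.density x i ∂ρ.totalVar =
      -(mu n α * ∫ x, f x * diffOp (coordKernel α i) u x) := by
  have ht := hu.smul_single i
  have h1 := hρ ⟨_, ht.1, ht.2, by simp⟩
  have h2 := fracFunctional_eq (α := α) (f := f) i u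
  rw [fracFunctional] at h2
  rw [h2, eq_neg_iff_add_eq_zero, add_comm, ← eq_neg_iff_add_eq_zero]
  refine h1.trans ?_
  rw [RadonVectorMeasure.integral]
  congr 2 with x
  change inner ℝ (u x • (EuclideanSpace.single i (1 : ℝ) : E n)) (ρ.density x) = _
  rw [real_inner_smul_left, EuclideanSpace.inner_single_left]
  simp

theorem distribDeriv_eq_zero_iff (hf : LocallyIntegrable f volume) (i : Fin n) :
    distribDeriv i f = 0 ↔ ∀ u : E n → ℝ, ContDiff ℝ (⊤ : ℕ∞) u → HasCompactSupport u →
      ∫ x, f x * fderiv ℝ u x (EuclideanSpace.single i (1 : ℝ)) = 0 := by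
  have key : ∀ φ : 𝓓((⊤ : Opens (E n)), ℝ), distribDeriv i f φ =
      -∫ x, f x * fderiv ℝ φ x (EuclideanSpace.single i (1 : ℝ)) := by
    intro φ
    rw [distribDeriv_apply i hf]
    congr 2 with x
    rw [mul_comm, (φ.contDiff.differentiable (by simp) x).lineDeriv_eq_fderiv]
  constructor
  · intro h u hu hs
    have h1 := key ⟨u, hu, hs, by simp⟩
    rw [h] at h1
    exact neg_eq_zero.1 h1.symm
  · intro h
    refine DFunLike.ext _ _ fun φ => ?_
    rw [key, h φ φ.contDiff φ.hasCompactSupport, neg_zero]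
    rfl

end FracBV

theorem proposition1p8 (n : ℕ) (α : ℝ) (hα0 : 0 < α) (hα1 : α < 1)
    (f : FracBV.E n → ℝ) (hf : FracBV.MemBVLoc α ∞ f) (i : Fin n) :
    (∃ ν : FracBV.RadonVectorMeasure n, FracBV.IsFracVariation α f ν) ∧
      ∀ ν : FracBV.RadonVectorMeasure n, FracBV.IsFracVariation α f ν →
        (ν.component i = 0 ↔ FracBV.distribDeriv i f = 0) := by
  refine ⟨FracBV.exists_isFracVariation hα0 hα1 hf, fun ν hν => ?_⟩
  -- The index i forces n ≥ 1; nontriviality of the space supplies the unit vectors and polar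
  -- coordinates used for the kernels.
  have : NeZero n := ⟨by rintro rfl; exact i.elim0⟩
  have hnt : Nontrivial (FracBV.E n) := inferInstance
  rw [ν.component_eq_zero_iff, FracBV.distribDeriv_eq_zero_iff (hf.1.locallyIntegrable le_top)]
  constructor
  · intro h u hu hs
    refine FracBV.integral_mul_fderiv_eq_zero hα0 hα1 hf.1 (fun w hw hws => ?_) hu hs
    have h1 := h w ⟨hw, hws⟩
    rw [hν.integral_density i ⟨hw, hws⟩, neg_eq_zero, mul_eq_zero] at h1
    exact h1.resolve_left (FracBV.mu_pos n hα0 hα1).ne'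
  · intro h u hu
    rw [hν.integral_density i hu,
      FracBV.integral_mul_diffOp_rieszKernel_eq_zero hα0 hα1 hf.1 h hu.1 hu.2, mul_zero, neg_zero]
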